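/- **Conventions.** A coherent sheaf $\mathcal F$ on a Noetherian scheme $X$ is a sheaf of $\mathcal O_X$-modules that is locally, on affine open subschemes $\operatorname{Spec} R$, of the form $\widetilde M$ with $M$ a finitely generated $R$-module; $\operatorname{Supp}\mathcal F=\{x\in X:\mathcal F_x\neq 0\}$, with the subspace topology. It is an $S_2$-sheaf if $\operatorname{depth}\mathcal F_x\ge \min\{2,\dim \mathcal F_x\}$ for every $x\in\operatorname{Supp}\mathcal F$. For a closed subset $Z$ of a Noetherian space $Y$, $\operatorname{codim}_Y Z$ is the infimum, over the irreducible closed subsets $W\subseteq Z$, of the supremum of the lengths of chains $W=W_0\subsetneq W_1\subsetneq\dots\subsetneq W_n$ of irreducible closed subsets of $Y$ (so $\operatorname{codim}_Y\emptyset=\infty$), and $\operatorname{codim}_Y(y)=\operatorname{codim}_Y\overline{\{y\}}$. Two irreducible components $C,D$ of $Y$ are equivalent if there is a chain $C=C_0,C_1,\dots,C_m=D$ of irreducible components with $\operatorname{codim}_Y(C_{i-1}\cap C_i)\le 1$ for all $i$; the connected components of $Y$ in codimension $1$ are the unions of the irreducible components in the equivalence classes. $Y$ is equidimensional if all its irreducible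 components have the same dimension. An object is indecomposable if it is nonzero and is not a direct sum of two nonzero objects. **Theorem.** Let $X$ be a Noetherian scheme and $\mathcal F$ a nonzero coherent $S_2$-sheaf on $X$. Then $\operatorname{Supp}\mathcal F$ has finitely many connected components in codimension $1$, and it is their union; let $$\operatorname{Supp}\mathcal F=S_1\cup\dots\cup S_r$$ be the decomposition into these (distinct) components. There is a decomposition $$\mathcal F\cong\bigoplus_{i=1}^r\mathcal F^{(i)},\qquad \operatorname{Supp}\mathcal F^{(i)}=S_i\quad(1\le i\le r),$$ into coherent $S_2$-sheaves. It is canonical up to reordering: if $\mathcal F\cong\bigoplus_{j=1}^s\mathcal H_j$ with $\mathcal H_j$ coherent and $\operatorname{Supp}\mathcal H_j=S_{\tau(j)}$ for a bijection $\tau:\{1,\dots,s\}\to\{1,\dots,r\}$, then $\mathcal H_j$ and $\mathcal F^{(\tau(j))}$ are the same subsheaf of $\mathcal F$ for every $j$. Moreover, assume that $\operatorname{Supp}\mathcal F$ is equidimensional and that the $\mathcal O_{X,x}$-module $\mathcal F_x$ is indecomposable for every $x\in\operatorname{Supp}\mathcal F$ with $\operatorname{codim}_{\operatorname{Supp}\mathcal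 F}(x)\le1$. Then each $\mathcal F^{(i)}$ is indecomposable, and this is the unique decomposition of $\mathcal F$ into indecomposables up to reordering: if $\mathcal F\cong\bigoplus_{j=1}^s\mathcal G_j$ with all $\mathcal G_j$ coherent and indecomposable, then there is a bijection $\tau:\{1,\dots,s\}\to\{1,\dots,r\}$ such that $\mathcal G_j$ and $\mathcal F^{(\tau(j))}$ are the same subsheaf of $\mathcal F$ for every $j$. -/

import Mathlib

open CategoryTheory CategoryTheory.Limits TopologicalSpace AlgebraicGeometry

universe u

noncomputable section

namespace S2Structure

section Topology

variable {Y : Type u} [TopologicalSpace Y]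

/-- The codimension in `Y` of a subset `Z` (used for closed subsets): the infimum, over the
irreducible closed subsets `W` of `Y` contained in `Z`, of the supremum of the lengths of chains
`W = W₀ ⊂ W₁ ⊂ ⋯ ⊂ Wₙ` of irreducible closed subsets of `Y`.
The codimension of the empty set is `⊤`. -/
def codim (Z : Set Y) : ℕ∞ :=
  ⨅ (W : IrreducibleCloseds Y) (_ : (W : Set Y) ⊆ Z), Order.coheight W

/-- The codimension of a point, i.e. of its closure. -/
def pointCodim (y : Y) : ℕ∞ := codim (closure ({y} : Set Y))

/-- Two irreducible components are adjacent in codimension `k` if their intersection has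
codimension at most `k` in the whole space. -/
def AdjacentInCodim (k : ℕ∞) (C D : irreducibleComponents Y) : Prop :=
  codim ((C : Set Y) ∩ (D : Set Y)) ≤ k

/-- The connected component in codimension `k` of an irreducible component `C`: the union of all
irreducible components which can be joined to `C` by a chain of irreducible components with
consecutive members adjacent in codimension `k`. -/
def codimComponent (k : ℕ∞) (C : irreducibleComponents Y) : Set Y :=
  ⋃ D ∈ {D : irreducibleComponents Y | Relation.ReflTransGen (AdjacentInCodim k) C D}, (D : Set Y)

/-- The connected components in codimension `k` of a subset `S` of a space (with the subspace
topology), regarded as subsets of the ambient space. -/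
def codimComponents (k : ℕ∞) (S : Set Y) : Set (Set Y) :=
  Set.range fun C : irreducibleComponents S => Subtype.val '' codimComponent k C

variable (Y) in
/-- All irreducible components have the same Krull dimension. -/
def Equidimensional : Prop :=
  ∀ C ∈ irreducibleComponents Y, ∀ D ∈ irreducibleComponents Y,
    topologicalKrullDim C = topologicalKrullDim D

end Topology

section Depth

variable (R : Type u) [CommRing R] [IsLocalRing R] (M : Type u) [AddCommGroup M] [Module R M]

/-- The depth of a (nonzero finitely generated) module over a (Noetherian) local ring: the
supremum of the lengths of regular sequences on `M` contained in the maximal ideal. -/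
def depth : ℕ∞ :=
  ⨆ (rs : List R) (_ : (∀ r ∈ rs, r ∈ IsLocalRing.maximalIdeal R) ∧
    RingTheory.Sequence.IsRegular M rs), (rs.length : ℕ∞)

end Depth

section Sheaves

variable {X : Scheme.{u}}

instance : HasFiniteBiproducts X.Modules := Abelian.hasFiniteBiproducts

/-- The stalk of a sheaf of modules. -/
abbrev Stalk (F : X.Modules) (x : X) : Type u := ↑(F.presheaf.stalk x)

instance stalkModule (F : X.Modules) (x : X) : Module (X.presheaf.stalk x) (Stalk F x) :=
  PresheafOfModules.instModuleCarrierStalkCommRingCatCarrierAbPresheafOpensCarrier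
    (R := X.presheaf) F.val x

/-- The module structure on the stalk is the one induced by the action on sections. -/
theorem germ_smul (F : X.Modules) (x : X) (U : X.Opens) (hx : x ∈ U) (r : Γ(X, U)) (m : Γ(F, U)) :
    F.presheaf.germ U x hx (r • m) =
      (X.presheaf.germ U x hx r • (F.presheaf.germ U x hx m : Stalk F x) : Stalk F x) :=
  PresheafOfModules.germ_smul (R := X.presheaf) F.val x U hx r m

/-- A sheaf of modules on a Noetherian scheme is coherent if locally on affine open subschemes
`Spec R` it is the sheaf associated to a finitely generated `R`-module. -/
def IsCoherent (F : X.Modules) : Prop :=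
  ∀ x : X, ∃ (R : CommRingCat.{u}) (f : Spec R ⟶ X) (_ : IsOpenImmersion f) (M : ModuleCat.{u} R),
    x ∈ Set.range f ∧ Module.Finite R M ∧ Nonempty (F.restrict f ≅ tilde M)

/-- The support: the set of points at which the stalk is nonzero. -/
def Supp (F : X.Modules) : Set X := {x | Nontrivial (Stalk F x)}

/-- Serre's condition `(S_n)`: `depth F_x ≥ min (n, dim F_x)` for all `x` in the support, where
`dim F_x` is the dimension of the support of the `𝒪_{X,x}`-module `F_x`. -/
def SatisfiesS (n : ℕ) (F : X.Modules) : Prop :=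
  ∀ x ∈ Supp F, min ((n : ℕ∞) : WithBot ℕ∞) (Module.supportDim (X.presheaf.stalk x) (Stalk F x)) ≤
    (depth (X.presheaf.stalk x) (Stalk F x) : WithBot ℕ∞)

/-- The stalk of `F` at `x` is indecomposable as an `𝒪_{X,x}`-module. -/
def IndecomposableStalk (F : X.Modules) (x : X) : Prop :=
  Indecomposable (ModuleCat.of (X.presheaf.stalk x) (Stalk F x))

/-- Given two decompositions `e : F ≅ ⨁ G` and `e' : F ≅ ⨁ H`, and a bijection `τ` between the
index sets, the summand `H j` is isomorphic to `G (τ j)` compatibly with the embeddings into `F`;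
that is, the two decompositions consist of the same subsheaves of `F` up to reordering by `τ`. -/
def SameDecomposition {r s : ℕ} {F : X.Modules} {G : Fin r → X.Modules} {H : Fin s → X.Modules}
    (e : F ≅ ⨁ G) (e' : F ≅ ⨁ H) (τ : Fin s ≃ Fin r) : Prop :=
  ∀ j, ∃ φ : H j ≅ G (τ j), biproduct.ι H j ≫ e'.inv = φ.hom ≫ biproduct.ι G (τ j) ≫ e.inv

end Sheaves

end S2Structure

end

/-!
An endomorphism of a coherent sheaf is determined by its stalks at the points of depth zero
(`IsCoherent.hom_ext_of_depth`), and for an `S₂`-sheaf `F` the only such points of the support are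
the generic points of its irreducible components (`SatisfiesS.end_ext`). Decompositions of `F` are
complete families of orthogonal idempotent endomorphisms, so every identity about them may be
checked at the generic points.

For existence, a point lying in two distinct connected components in codimension one has codimension
at least two in the support, so `F` has depth at least two there by `(S₂)`. If closed sets `S` and
`T` cover the support and `F` has depth at least two along `S ∩ T`, then `F` splits into parts
supported in `S` and in `T` (`exists_projection`). On an affine chart this says that a finite module
is the sum of its torsion submodules with respect to the ideals of `S` and `T`
(`powTorsion_sup_powTorsion_eq_top`), an associated prime argument replacing the extension of
sections over a closed subset of depth at least two; the local parts are unique and glue. Separating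
each component `S_i` from the others gives idempotents which at the generic points are the identity
on `S_i` and zero elsewhere, hence orthogonal with sum one. Any decomposition with supports `S_i`
has the same idempotents at the generic points, hence is the same.

If the stalks at points of codimension at most one are indecomposable, an idempotent endomorphism is
zero or the identity on each of these stalks, and on their generizations with it. Two irreducible
components meeting in codimension one have a common such point, so the idempotent is constantly zero
or constantly the identity at the generic points of each `S_i`
(`stalkHom_eq_zero_or_eq_id_of_mem_codimComponent`). Thus it kills or fixes each summand, which
makes the summands indecomposable and, as in the Krull–Schmidt theorem, the decomposition unique
(`exists_equiv_summandProj_eq`).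
-/

noncomputable section

namespace S2Structure

/-! ### Splitting a module along an ideal -/

section Algebra

variable {R : Type*} [CommRing R] {M : Type*} [AddCommGroup M] [Module R M]

/-- A nonzero element of a module over a Noetherian ring has a multiple whose annihilator `P` is
prime: an associated prime found inside the cyclic submodule. -/
theorem exists_smul_annihilator_isPrime [IsNoetherianRing R] {x : M} (hx : x ≠ 0) :
    ∃ (P : Ideal R) (r : R), P.IsPrime ∧ ∀ a, a ∈ P ↔ a • r • x = 0 := by
  obtain ⟨P, ⟨r, hr, rfl⟩, hmax⟩ := set_has_maximal_iff_noetherian.mpr ‹IsNoetherianRing R›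
    {I : Ideal R | ∃ r : R, r • x ≠ 0 ∧ I = LinearMap.ker (LinearMap.toSpanSingleton R M (r • x))}
    ⟨_, 1, by simpa using hx, rfl⟩
  refine ⟨LinearMap.ker (LinearMap.toSpanSingleton R M (r • x)), r, ⟨?_, ?_⟩, fun a => by
    rw [LinearMap.mem_ker, LinearMap.toSpanSingleton_apply]⟩
  · intro h
    exact hr (by simpa using (h ▸ Submodule.mem_top : (1 : R) ∈
      LinearMap.ker (LinearMap.toSpanSingleton R M (r • x))))
  · intro a b hab
    by_contra! h
    obtain ⟨ha, hb⟩ := h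
    simp only [LinearMap.mem_ker, LinearMap.toSpanSingleton_apply] at ha hb hab
    refine hmax _ ⟨a * r, by rwa [mul_smul], rfl⟩ (lt_of_le_of_ne ?_ ?_)
    · intro c hc
      simp only [LinearMap.mem_ker, LinearMap.toSpanSingleton_apply] at hc ⊢
      rw [mul_smul, smul_comm, hc, smul_zero]
    · intro h
      have : b ∈ LinearMap.ker (LinearMap.toSpanSingleton R M ((a * r) • x)) := by
        simp only [LinearMap.mem_ker, LinearMap.toSpanSingleton_apply]
        rw [mul_smul, ← mul_smul b, mul_comm b a, hab]
      rw [← h] at this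
      exact hb (by simpa using this)

variable (M) in
/-- The submodule of elements annihilated by some power of the ideal `I`. -/
def powTorsion (I : Ideal R) : Submodule R M where
  carrier := {u | ∃ k : ℕ, ∀ c ∈ I ^ k, c • u = 0}
  zero_mem' := ⟨0, by simp⟩
  add_mem' := by
    rintro u v ⟨k, hk⟩ ⟨l, hl⟩
    refine ⟨k + l, fun c hc => ?_⟩
    rw [smul_add, hk c (Ideal.pow_le_pow_right (Nat.le_add_right k l) hc),
      hl c (Ideal.pow_le_pow_right (Nat.le_add_left l k) hc), add_zero]
  smul_mem' := by
    rintro r u ⟨k, hk⟩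
    exact ⟨k, fun c hc => by rw [smul_comm, hk c hc, smul_zero]⟩

/-- If a finitely generated submodule vanishes in the localization at `P`, a single element outside
`P` kills it. -/
theorem exists_notMem_smul_eq_zero [IsNoetherian R M] {P : Ideal R} (hP : P.IsPrime)
    (N : Submodule R M) (h : ∀ m ∈ N, ∃ g ∉ P, g • m = 0) :
    ∃ g ∉ P, ∀ m ∈ N, g • m = 0 := by
  obtain ⟨s, hs⟩ := IsNoetherian.noetherian N
  have h' : ∀ m : s, ∃ g ∉ P, g • (m : M) = 0 :=
    fun m => h m (hs ▸ Submodule.subset_span m.2)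
  choose g hg hgm using h'
  refine ⟨∏ m : s, g m, fun hmem => ?_, fun m hm => ?_⟩
  · obtain ⟨m, -, hm⟩ := (Ideal.IsPrime.prod_mem_iff (hp := hP)).mp hmem
    exact hg m hm
  · rw [← hs] at hm
    induction hm using Submodule.span_induction with
    | mem x hx =>
      obtain ⟨c, hc⟩ := Finset.dvd_prod_of_mem g (Finset.mem_univ ⟨x, hx⟩)
      rw [hc, mul_comm, mul_smul, hgm ⟨x, hx⟩, smul_zero]
    | zero => simp
    | add x y _ _ hx hy => rw [smul_add, hx, hy, add_zero]
    | smul r x _ hx => rw [smul_comm, hx, smul_zero]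

/-- The algebraic core of the splitting. Suppose that `M` is supported on `V(I) ∪ V(J)` and that at
each prime `P ∈ V(I) ∩ V(J)` the localization `M_P` has depth at least two, expressed by `a, b ∈ P`
forming a regular sequence up to denominators outside `P`. Then `M` is the sum of its `I`-power
torsion and its `J`-power torsion. Otherwise the quotient `M / (M_I + M_J)` has an associated prime
`P`, which contains `I` and `J`. An element `x` whose class has annihilator `P` has `a • x` and
`b • x` in the direct sum `M_I ⊕ M_J`, and comparing components the regularity of `a, b` shows that
`x` itself is in this sum, locally at `P`. -/
theorem powTorsion_sup_powTorsion_eq_top [IsNoetherianRing R] [Module.Finite R M]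
    (I J : Ideal R) {n : ℕ} (hIJ : ∀ c ∈ (I * J) ^ n, ∀ m : M, c • m = 0)
    (hdepth : ∀ P : Ideal R, P.IsPrime → I ≤ P → J ≤ P → ∃ a ∈ P, ∃ b ∈ P,
      (∀ m : M, a • m = 0 → ∃ h ∉ P, h • m = 0) ∧
      ∀ m m' : M, b • m = a • m' → ∃ g ∉ P, ∃ w : M, g • m = a • w) :
    powTorsion M I ⊔ powTorsion M J = ⊤ := by
  -- the sum is direct, as an associated prime of the intersection would have depth zero
  have hinf : ∀ x ∈ powTorsion M I, x ∈ powTorsion M J → x = 0 := by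
    rintro x ⟨k, hk⟩ ⟨l, hl⟩
    by_contra hx
    obtain ⟨P, r, hP, hPr⟩ := exists_smul_annihilator_isPrime (R := R) hx
    have hIP : I ≤ P := fun c hc => hP.mem_of_pow_mem k <| (hPr _).mpr <| by
      rw [smul_comm, hk _ (Ideal.pow_mem_pow hc k), smul_zero]
    have hJP : J ≤ P := fun c hc => hP.mem_of_pow_mem l <| (hPr _).mpr <| by
      rw [smul_comm, hl _ (Ideal.pow_mem_pow hc l), smul_zero]
    obtain ⟨a, ha, b, hb, h1, -⟩ := hdepth P hP hIP hJP
    obtain ⟨h, hh, hhx⟩ := h1 _ ((hPr a).mp ha)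
    exact hh ((hPr h).mpr hhx)
  by_contra htop
  obtain ⟨s, hs⟩ : ∃ s : M, s ∉ powTorsion M I ⊔ powTorsion M J := by
    by_contra! h
    exact htop (eq_top_iff.mpr fun x _ => h x)
  obtain ⟨P, r, hP, hPr⟩ := exists_smul_annihilator_isPrime (R := R)
    (x := (powTorsion M I ⊔ powTorsion M J).mkQ s) (by simpa using hs)
  replace hPr : ∀ a, a ∈ P ↔ a • r • s ∈ powTorsion M I ⊔ powTorsion M J := fun a => by
    rw [hPr, ← map_smul, ← map_smul, Submodule.mkQ_apply, Submodule.Quotient.mk_eq_zero]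
  set x := r • s
  have hIP : I ≤ P := fun c hc => hP.mem_of_pow_mem n <| (hPr _).mpr <|
    Submodule.mem_sup_right ⟨n, fun d hd => by
      rw [← mul_smul]
      refine hIJ _ ?_ _
      rw [mul_comm d, mul_pow]
      exact Ideal.mul_mem_mul (Ideal.pow_mem_pow hc n) hd⟩
  have hJP : J ≤ P := fun c hc => hP.mem_of_pow_mem n <| (hPr _).mpr <|
    Submodule.mem_sup_left ⟨n, fun d hd => by
      rw [← mul_smul]
      refine hIJ _ ?_ _
      rw [mul_pow]
      exact Ideal.mul_mem_mul hd (Ideal.pow_mem_pow hc n)⟩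
  obtain ⟨a, ha, b, hb, h1, h2⟩ := hdepth P hP hIP hJP
  obtain ⟨u, hu, u', hu', hua⟩ := Submodule.mem_sup.mp ((hPr a).mp ha)
  obtain ⟨v, hv, v', hv', hvb⟩ := Submodule.mem_sup.mp ((hPr b).mp hb)
  -- `b • (a • x) = a • (b • x)`, compared componentwise in the direct sum of the two torsion parts
  have hz : b • u - a • v = 0 := by
    have hmem := (powTorsion M I).sub_mem ((powTorsion M I).smul_mem b hu)
      ((powTorsion M I).smul_mem a hv)
    have heq : b • u - a • v = a • v' - b • u' := by
      have : b • (u + u') = a • (v + v') := by rw [hua, hvb, smul_comm]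
      rw [smul_add, smul_add] at this
      rw [sub_eq_sub_iff_add_eq_add, this, add_comm]
    refine hinf _ hmem ?_
    rw [heq]
    exact (powTorsion M J).sub_mem ((powTorsion M J).smul_mem a hv')
      ((powTorsion M J).smul_mem b hu')
  have hz' : b • u' = a • v' := by
    have : b • (u + u') = a • (v + v') := by rw [hua, hvb, smul_comm]
    rw [smul_add, smul_add, sub_eq_zero.mp hz] at this
    exact add_left_cancel this
  obtain ⟨g, hg, w, hw⟩ := h2 u v (sub_eq_zero.mp hz)
  obtain ⟨g', hg', w', hw'⟩ := h2 u' v' hz'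
  -- one element outside `P` kills all the `a`-torsion
  obtain ⟨h, hh, hah⟩ := exists_notMem_smul_eq_zero hP
    (LinearMap.ker (LinearMap.lsmul R M a)) (by simpa using h1)
  simp only [LinearMap.mem_ker, LinearMap.lsmul_apply] at hah
  have key : ∀ (K : Ideal R) (y z : M) (c : R), y ∈ powTorsion M K → c • y = a • z →
      h • z ∈ powTorsion M K := by
    rintro K y z c ⟨k, hk⟩ hyz
    refine ⟨k, fun d hd => ?_⟩
    rw [smul_comm]
    refine hah _ ?_
    rw [smul_comm, ← hyz, smul_comm, hk d hd, smul_zero]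
  have hwI := key I u w g hu hw
  have hwJ := key J u' w' g' hu' hw'
  have hsub : h • ((g' * g) • x - g' • w - g • w') = 0 := by
    refine hah _ ?_
    rw [smul_sub, smul_sub, smul_comm a g' w, ← hw, smul_comm a g w', ← hw', smul_comm a, ← hua,
      ← mul_smul, ← mul_smul, mul_comm g g', smul_add]
    abel
  have : (h * (g' * g)) • x ∈ powTorsion M I ⊔ powTorsion M J := by
    rw [smul_sub, smul_sub, sub_sub, sub_eq_zero, ← mul_smul] at hsub
    rw [hsub]
    refine Submodule.add_mem _ (Submodule.mem_sup_left ?_) (Submodule.mem_sup_right ?_)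
    · rw [smul_comm]; exact Submodule.smul_mem _ _ hwI
    · rw [smul_comm]; exact Submodule.smul_mem _ _ hwJ
  have hmem := (hPr _).mpr this
  rcases hP.mem_or_mem hmem with h' | h'
  · exact hh h'
  · rcases hP.mem_or_mem h' with h' | h'
    · exact hg' h'
    · exact hg h'

end Algebra

/-! ### Depth of direct summands, and regular sequences -/

section Depth

theorem isWeaklyRegular_of_retract {R : Type*} [CommRing R] (rs : List R) {M N : Type*}
    [AddCommGroup M] [Module R M] [AddCommGroup N] [Module R N] (i : N →ₗ[R] M) (q : M →ₗ[R] N)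
    (hqi : q ∘ₗ i = LinearMap.id) (h : RingTheory.Sequence.IsWeaklyRegular M rs) :
    RingTheory.Sequence.IsWeaklyRegular N rs := by
  induction rs generalizing M N with
  | nil => exact RingTheory.Sequence.IsWeaklyRegular.nil R N
  | cons r rs ih =>
    rw [RingTheory.Sequence.isWeaklyRegular_cons_iff] at h ⊢
    refine ⟨h.1.of_injective i ?_, ih (QuotSMulTop.map r i) (QuotSMulTop.map r q) ?_ h.2⟩
    · exact Function.LeftInverse.injective (g := q) fun x => LinearMap.congr_fun hqi x
    · rw [← QuotSMulTop.map_comp, hqi, QuotSMulTop.map_id]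

variable {R : Type u} [CommRing R] [IsLocalRing R] {M N : Type u} [AddCommGroup M] [Module R M]
  [AddCommGroup N] [Module R N]

theorem depth_le_depth_of_retract [Module.Finite R N] [Nontrivial N] (i : N →ₗ[R] M)
    (q : M →ₗ[R] N) (hqi : q ∘ₗ i = LinearMap.id) : depth R M ≤ depth R N := by
  refine iSup₂_le fun rs hrs => ?_
  refine le_iSup₂_of_le rs ⟨hrs.1, ?_⟩ le_rfl
  exact RingTheory.Sequence.IsRegular.of_isWeaklyRegular_of_mem_maximalIdeal _ hrs.1
    (isWeaklyRegular_of_retract rs i q hqi hrs.2.toIsWeaklyRegular)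

theorem exists_isRegular_of_le_depth {n : ℕ} (hn : n ≠ 0) (h : (n : ℕ∞) ≤ depth R M) :
    ∃ rs : List R, (∀ r ∈ rs, r ∈ IsLocalRing.maximalIdeal R) ∧
      RingTheory.Sequence.IsRegular M rs ∧ n ≤ rs.length := by
  obtain ⟨m, rfl⟩ := Nat.exists_eq_succ_of_ne_zero hn
  have h' : (m : ℕ∞) < depth R M := lt_of_lt_of_le (by exact_mod_cast Nat.lt_succ_self m) h
  obtain ⟨rs, hrs⟩ := lt_iSup_iff.mp h'
  obtain ⟨h1, h2⟩ := lt_iSup_iff.mp hrs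
  exact ⟨rs, h1.1, h1.2, by exact_mod_cast h2⟩

theorem exists_isSMulRegular_of_one_le_depth (h : 1 ≤ depth R M) :
    ∃ α ∈ IsLocalRing.maximalIdeal R, IsSMulRegular M α := by
  obtain ⟨rs, hm, hreg, hl⟩ := exists_isRegular_of_le_depth (n := 1) one_ne_zero (by simpa using h)
  match rs, hl with
  | α :: rs, _ =>
    exact ⟨α, hm _ (by simp),
      ((RingTheory.Sequence.isWeaklyRegular_cons_iff M α rs).mp hreg.toIsWeaklyRegular).1⟩

/-- Depth at least two gives a regular pair `α, β`; the regularity of `β` on `M / α M` is spelled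
out without the quotient. -/
theorem exists_isRegular_pair_of_two_le_depth (h : 2 ≤ depth R M) :
    ∃ α ∈ IsLocalRing.maximalIdeal R, ∃ β ∈ IsLocalRing.maximalIdeal R, IsSMulRegular M α ∧
      ∀ z z' : M, β • z = α • z' → ∃ w : M, z = α • w := by
  obtain ⟨rs, hm, hreg, hl⟩ := exists_isRegular_of_le_depth (n := 2) two_ne_zero (by simpa using h)
  match rs, hl with
  | α :: β :: rs, _ =>
    have h1 := (RingTheory.Sequence.isWeaklyRegular_cons_iff M α _).mp hreg.toIsWeaklyRegular
    have h2 := (RingTheory.Sequence.isWeaklyRegular_cons_iff _ β _).mp h1.2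
    refine ⟨α, hm _ (by simp), β, hm _ (by simp), h1.1, fun z z' hzz' => ?_⟩
    have h3 : (Submodule.Quotient.mk z : QuotSMulTop α M) = 0 := by
      refine h2.1.right_eq_zero_of_smul ?_
      rw [← Submodule.Quotient.mk_smul, hzz', Submodule.Quotient.mk_eq_zero]
      exact Submodule.smul_mem_pointwise_smul _ _ _ trivial
    rw [Submodule.Quotient.mk_eq_zero, Submodule.mem_smul_pointwise_iff_exists] at h3
    obtain ⟨w, -, hw⟩ := h3
    exact ⟨w, hw.symm⟩

end Depth

/-! ### Indecomposability in terms of idempotents -/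

section Idempotents

variable {C : Type*} [Category* C] [Preadditive C]

theorem isZero_fst_of_comp_eq_zero [HasBinaryBiproducts C] {Z A B : C} (e : Z ≅ A ⊞ B)
    (h : e.hom ≫ biprod.fst ≫ biprod.inl ≫ e.inv = 0) : IsZero A := by
  rw [IsZero.iff_id_eq_zero]
  calc 𝟙 A = biprod.inl ≫ e.inv ≫ (e.hom ≫ biprod.fst ≫ biprod.inl ≫ e.inv) ≫ e.hom ≫
          biprod.fst := by simp
    _ = 0 := by rw [h]; simp

theorem isZero_snd_of_comp_eq_id [HasBinaryBiproducts C] {Z A B : C} (e : Z ≅ A ⊞ B)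
    (h : e.hom ≫ biprod.fst ≫ biprod.inl ≫ e.inv = 𝟙 Z) : IsZero B := by
  rw [IsZero.iff_id_eq_zero]
  calc 𝟙 B = biprod.inr ≫ e.inv ≫ 𝟙 Z ≫ e.hom ≫ biprod.snd := by simp
    _ = 0 := by rw [← h]; simp

variable [HasBinaryBiproducts C]

/-- In an idempotent complete category an idempotent `p` of an indecomposable object is trivial, as
the images of `p` and `1 - p` decompose the object. -/
theorem Indecomposable.eq_zero_or_eq_id [IsIdempotentComplete C] {Z : C} (hZ : Indecomposable Z)
    (p : Z ⟶ Z) (hp : p ≫ p = p) : p = 0 ∨ p = 𝟙 Z := by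
  obtain ⟨A, i, q, hiq, hqi⟩ := IsIdempotentComplete.idempotents_split Z p hp
  obtain ⟨B, j, t, hjt, htj⟩ := IsIdempotentComplete.idempotents_split Z (𝟙 Z - p) (by simp [hp])
  have hit : i ≫ t = 0 := by
    have : i ≫ t ≫ j = 0 := by rw [htj, ← hqi]; simp [reassoc_of% hiq]
    calc i ≫ t = (i ≫ t ≫ j) ≫ t := by simp [hjt]
      _ = 0 := by rw [this, zero_comp]
  have hjq : j ≫ q = 0 := by
    have : j ≫ q ≫ i = 0 := by
      rw [hqi, show p = 𝟙 Z - (𝟙 Z - p) by simp, ← htj]; simp [reassoc_of% hjt]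
    calc j ≫ q = (j ≫ q ≫ i) ≫ q := by simp [hiq]
      _ = 0 := by rw [this, zero_comp]
  let e : Z ≅ A ⊞ B :=
    { hom := biprod.lift q t
      inv := biprod.desc i j
      hom_inv_id := by simp [biprod.lift_desc, hqi, htj]
      inv_hom_id := by ext <;> simp [hiq, hjt, hit, hjq] }
  rcases hZ.2 A B e with h | h
  · left; rw [← hqi, h.eq_zero_of_tgt q, zero_comp]
  · right
    have : 𝟙 Z - p = 0 := by rw [← htj, h.eq_zero_of_tgt t, zero_comp]
    exact (sub_eq_zero.mp this).symm

theorem indecomposable_of_idempotents {Z : C} (hZ : ¬ IsZero Z)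
    (h : ∀ p : Z ⟶ Z, p ≫ p = p → p = 0 ∨ p = 𝟙 Z) : Indecomposable Z := by
  refine ⟨hZ, fun A B e => ?_⟩
  rcases h (e.hom ≫ biprod.fst ≫ biprod.inl ≫ e.inv) (by simp) with h | h
  · exact Or.inl (isZero_fst_of_comp_eq_zero e h)
  · exact Or.inr (isZero_snd_of_comp_eq_id e h)

end Idempotents

open Scheme.Modules

/-! ### Affine charts of a coherent sheaf -/

section Charts

variable {X : Scheme.{u}}

/-- An affine open subset `W` is a chart of `F` if `Γ(F, W)` is a finite module over `Γ(X, W)` and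
the germ maps `Γ(F, W) → F_y` are localizations at the primes of `Γ(X, W)` given by the points
`y ∈ W`. -/
structure IsChart (F : X.Modules) (W : X.Opens) : Prop where
  isAffineOpen : IsAffineOpen W
  finite : Module.Finite Γ(X, W) Γ(F, W)
  surj : ∀ (y : X) (hy : y ∈ W) (z : Stalk F y), ∃ (a : Γ(X, W)) (m : Γ(F, W)),
    y ∈ X.basicOpen a ∧ X.presheaf.germ W y hy a • z = F.presheaf.germ W y hy m
  inj : ∀ (y : X) (hy : y ∈ W) (m : Γ(F, W)), F.presheaf.germ W y hy m = 0 →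
    ∃ a : Γ(X, W), y ∈ X.basicOpen a ∧ a • m = 0

theorem isLocalizing_of_iso_tilde {R : CommRingCat.{u}} {G : (Spec R).Modules} {M : ModuleCat.{u} R}
    (e : G ≅ tilde M) : IsLocalizing (modulesSpecToSheaf.obj G) :=
  isLocalizing_of_iso (modulesSpecToSheaf.mapIso e.symm) (isLocalizing_tilde M)

theorem finite_sections_of_iso_tilde {R : CommRingCat.{u}} {G : (Spec R).Modules}
    {M : ModuleCat.{u} R} [Module.Finite R M] (e : G ≅ tilde M) : Module.Finite R Γ(G, ⊤) := by
  let e' : M ≅ (modulesSpecToSheaf.obj G).presheaf.obj (.op ⊤) :=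
    tilde.isoTop M ≪≫ ((TopCat.Sheaf.forget _ _ ⋙ (evaluation _ _).obj (.op ⊤)).mapIso
      (modulesSpecToSheaf.mapIso e.symm))
  exact Module.Finite.equiv e'.toLinearEquiv

/-- A section of `M~` over a basic open set extends globally after multiplication by a power of the
function. -/
theorem exists_pow_smul_eq_res {R : CommRingCat.{u}} {G : (Spec R).Modules} {M : ModuleCat.{u} R}
    (e : G ≅ tilde M) (r : R) {D : (Spec R).Opens} (hD : D = PrimeSpectrum.basicOpen r)
    (t : Γ(G, D)) : ∃ (n : ℕ) (m : Γ(G, ⊤)), r ^ n • t = G.presheaf.map (homOfLE le_top).op m := by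
  subst hD
  have := isLocalizing_of_iso_tilde e r
  have key := IsLocalizedModule.surj (.powers r)
    ((modulesSpecToSheaf.obj G).obj.map (PrimeSpectrum.basicOpen r).leTop.op).hom
  obtain ⟨⟨m, ⟨_, n, rfl⟩⟩, hm⟩ := key t
  exact ⟨n, m, hm⟩

/-- A global section of `M~` vanishing on a basic open set is killed by a power of the function. -/
theorem exists_pow_smul_eq_zero {R : CommRingCat.{u}} {G : (Spec R).Modules} {M : ModuleCat.{u} R}
    (e : G ≅ tilde M) (r : R) {D : (Spec R).Opens} (hD : D = PrimeSpectrum.basicOpen r)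
    (m : Γ(G, ⊤)) (hm : G.presheaf.map (homOfLE le_top : D ⟶ ⊤).op m = 0) :
    ∃ n : ℕ, r ^ n • m = 0 := by
  subst hD
  have := isLocalizing_of_iso_tilde e r
  obtain ⟨⟨_, n, rfl⟩, hn⟩ := (IsLocalizedModule.eq_zero_iff (.powers r)
    ((modulesSpecToSheaf.obj G).obj.map (PrimeSpectrum.basicOpen r).leTop.op).hom).mp hm
  exact ⟨n, hn⟩

variable {R : CommRingCat.{u}} (f : Spec R ⟶ X) [IsOpenImmersion f]

/-- For an open immersion `f : Spec R ⟶ X`, the identification of `R` with the ring of functions on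
the image of `f`. -/
def toImageSections : R ⟶ Γ(X, f ''ᵁ ⊤) :=
  (Scheme.ΓSpecIso R).inv ≫ (f.appIso ⊤).inv

theorem restrictAppIso_hom_smul (F : X.Modules) (U : (Spec R).Opens) (r : R)
    (m : Γ(F.restrict f, U)) :
    (F.restrictAppIso f U).hom (r • m) =
      X.presheaf.map (homOfLE (f.image_mono le_top) : f ''ᵁ U ⟶ f ''ᵁ ⊤).op
        (toImageSections f r) • (F.restrictAppIso f U).hom m := by
  rw [smul_Spec_def]
  change (f.appIso U).inv ((Spec R).presheaf.map U.leTop.op ((Scheme.ΓSpecIso R).inv r)) •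
    (F.restrictAppIso f U).hom m = _
  congr 1
  rw [← ConcreteCategory.comp_apply, Scheme.Hom.appIso_inv_naturality]
  rfl

theorem mem_basicOpen_toImageSections (r : R) (y : Spec R) (hy : y ∈ PrimeSpectrum.basicOpen r) :
    f y ∈ X.basicOpen (toImageSections f r) := by
  have h : f ''ᵁ (Spec R).basicOpen ((Scheme.ΓSpecIso R).inv r) =
      X.basicOpen (toImageSections f r) := Scheme.image_basicOpen f _
  rw [← h]
  refine ⟨y, ?_, rfl⟩
  rw [basicOpen_eq_of_affine]
  exact hy

/-- The chart of a coherent sheaf given by an open immersion `f : Spec R ⟶ X` over which the sheaf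
is `M~` with `M` finite. `R`-linear statements are transported along `toImageSections`. -/
theorem isChart_image (F : X.Modules) {M : ModuleCat.{u} R} [Module.Finite R M]
    (e : F.restrict f ≅ tilde M) : IsChart F (f ''ᵁ ⊤) where
  isAffineOpen := (isAffineOpen_top (Spec R)).image_of_isOpenImmersion f
  finite := by
    have hfin := finite_sections_of_iso_tilde e
    obtain ⟨s, hs⟩ := hfin.fg_top
    refine ⟨Submodule.fg_def.mpr ⟨(F.restrictAppIso f ⊤).hom '' s, s.finite_toSet.image _, ?_⟩⟩
    rw [eq_top_iff]
    intro m _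
    have hm : ∀ m' : Γ(F.restrict f, ⊤), m' ∈ Submodule.span R (s : Set Γ(F.restrict f, ⊤)) →
        (F.restrictAppIso f ⊤).hom m' ∈
          Submodule.span Γ(X, f ''ᵁ ⊤) ((F.restrictAppIso f ⊤).hom '' s) := ?_
    · exact hm m (hs ▸ Submodule.mem_top)
    intro m' hm
    induction hm using Submodule.span_induction with
    | mem x hx => exact Submodule.subset_span ⟨x, hx, rfl⟩
    | zero => rw [map_zero]; exact Submodule.zero_mem _
    | add x y _ _ hx hy => rw [map_add]; exact Submodule.add_mem _ hx hy
    | smul r x _ hx =>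
      rw [restrictAppIso_hom_smul]
      exact Submodule.smul_mem _ _ hx
  surj := by
    rintro _ ⟨y, hy', rfl⟩ z
    obtain ⟨U, hyU, t, rfl⟩ := F.presheaf.exists_germ_eq z
    obtain ⟨_, ⟨_, ⟨r, rfl⟩, rfl⟩, hyr, hrU⟩ :=
      PrimeSpectrum.isBasis_basic_opens.exists_subset_of_mem_open (u := (f ⁻¹ᵁ U : Set (Spec R)))
        hyU (f ⁻¹ᵁ U).2
    obtain ⟨D, hD⟩ : ∃ D : (Spec R).Opens, D = PrimeSpectrum.basicOpen r := ⟨_, rfl⟩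
    have hle : f ''ᵁ D ≤ U := by
      rintro _ ⟨w, hw, rfl⟩; exact hrU (hD ▸ hw)
    have hmem : f y ∈ f ''ᵁ D := ⟨y, hD ▸ hyr, rfl⟩
    obtain ⟨n, m, hm⟩ := exists_pow_smul_eq_res e r hD
      ((F.restrictAppIso f D).inv (F.presheaf.map (homOfLE hle).op t))
    refine ⟨toImageSections f (r ^ n), m, mem_basicOpen_toImageSections f _ y
      (fun h => hyr (y.isPrime.mem_of_pow_mem n h)), ?_⟩
    replace hm := (restrictAppIso_hom_smul f F D _ _).symm.trans
      congr((F.restrictAppIso f D).hom $hm)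
    have := congr(F.presheaf.germ _ (f y) hmem $hm)
    refine Eq.trans ?_ (this.trans ?_)
    · refine Eq.trans ?_ (germ_smul F _ _ _ _ _).symm
      refine congrArg₂ (fun (a : X.presheaf.stalk (f y)) (b : Stalk F (f y)) => a • b) ?_ ?_
      · exact (TopCat.Presheaf.germ_res_apply X.presheaf (homOfLE (f.image_mono le_top)) _ _ _).symm
      · exact (TopCat.Presheaf.germ_res_apply F.presheaf (homOfLE hle) _ _ _).symm
    · exact TopCat.Presheaf.germ_res_apply F.presheaf (homOfLE (f.image_mono le_top)) _ _ _
  inj := by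
    rintro _ ⟨y, hy', rfl⟩ m hm
    have hy : f y ∈ f ''ᵁ ⊤ := ⟨y, trivial, rfl⟩
    have h0 : F.presheaf.germ _ (f y) hy m = F.presheaf.germ _ (f y) hy 0 := by
      rw [map_zero]; exact hm
    obtain ⟨U, hyU, i, i', h⟩ := F.presheaf.germ_eq (f y) hy hy m 0 h0
    rw [map_zero] at h
    obtain ⟨_, ⟨_, ⟨r, rfl⟩, rfl⟩, hyr, hrU⟩ :=
      PrimeSpectrum.isBasis_basic_opens.exists_subset_of_mem_open (u := (f ⁻¹ᵁ U : Set (Spec R)))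
        hyU (f ⁻¹ᵁ U).2
    obtain ⟨D, hD⟩ : ∃ D : (Spec R).Opens, D = PrimeSpectrum.basicOpen r := ⟨_, rfl⟩
    have hle : f ''ᵁ D ≤ U := by
      rintro _ ⟨w, hw, rfl⟩; exact hrU (hD ▸ hw)
    have hD0 := congr(F.presheaf.map (homOfLE hle).op $h)
    rw [map_zero, ← ConcreteCategory.comp_apply, ← Functor.map_comp] at hD0
    obtain ⟨n, hn⟩ := exists_pow_smul_eq_zero e r hD m hD0
    refine ⟨toImageSections f (r ^ n), mem_basicOpen_toImageSections f _ y
      (fun h => hyr (y.isPrime.mem_of_pow_mem n h)), ?_⟩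
    refine Eq.trans ?_ ((restrictAppIso_hom_smul f F ⊤ _ _).symm.trans
      (congr((F.restrictAppIso f ⊤).hom $hn).trans (map_zero _)))
    congr 1
    have : (homOfLE (f.image_mono le_top) : f ''ᵁ ⊤ ⟶ f ''ᵁ ⊤) = 𝟙 _ := rfl
    rw [this]
    simp

theorem IsCoherent.exists_isChart {F : X.Modules} (hF : IsCoherent F) (x : X) :
    ∃ W : X.Opens, x ∈ W ∧ IsChart F W := by
  obtain ⟨R, f, hf, M, ⟨y, rfl⟩, hM, ⟨e⟩⟩ := hF x
  exact ⟨f ''ᵁ ⊤, ⟨y, trivial, rfl⟩, isChart_image f F e⟩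

end Charts

/-! ### Morphisms on stalks, and the local structure of coherent sheaves -/

section Stalks

variable {X : Scheme.{u}} {F G H : X.Modules}

theorem germ_res (F : X.Modules) {U V : X.Opens} (h : V ≤ U) (x : X) (hx : x ∈ V) (m : Γ(F, U)) :
    F.presheaf.germ V x hx (F.presheaf.map (homOfLE h).op m) = F.presheaf.germ U x (h hx) m :=
  TopCat.Presheaf.germ_res_apply F.presheaf (homOfLE h) x hx m

theorem exists_germ_pair {x : X} (r : X.presheaf.stalk x) (z : Stalk F x) :
    ∃ (U : X.Opens) (hx : x ∈ U) (a : Γ(X, U)) (m : Γ(F, U)),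
      X.presheaf.germ U x hx a = r ∧ F.presheaf.germ U x hx m = z := by
  obtain ⟨U, hU, a, rfl⟩ := X.presheaf.exists_germ_eq r
  obtain ⟨V, hV, m, rfl⟩ := F.presheaf.exists_germ_eq z
  exact ⟨U ⊓ V, ⟨hU, hV⟩, X.presheaf.map (homOfLE inf_le_left).op a,
    F.presheaf.map (homOfLE inf_le_right).op m,
    TopCat.Presheaf.germ_res_apply X.presheaf (homOfLE inf_le_left) x _ a,
    germ_res F inf_le_right x _ m⟩

/-- The map induced on stalks by a morphism of sheaves of modules. -/
def stalkHom (φ : F ⟶ G) (x : X) : Stalk F x →ₗ[X.presheaf.stalk x] Stalk G x where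
  toFun := (TopCat.Presheaf.stalkFunctor Ab.{u} x).map φ.mapPresheaf
  map_add' _ _ := map_add _ _ _
  map_smul' r z := by
    obtain ⟨U, hx, a, m, rfl, rfl⟩ := exists_germ_pair r z
    have h : ∀ m : Γ(F, U), (TopCat.Presheaf.stalkFunctor Ab.{u} x).map φ.mapPresheaf
        (F.presheaf.germ U x hx m) = G.presheaf.germ U x hx (φ.app U m) :=
      TopCat.Presheaf.stalkFunctor_map_germ_apply U x hx φ.mapPresheaf
    rw [← germ_smul, h, Hom.app_smul, germ_smul, h]
    rfl

theorem stalkHom_germ (φ : F ⟶ G) {U : X.Opens} {x : X} (hx : x ∈ U) (m : Γ(F, U)) :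
    stalkHom φ x (F.presheaf.germ U x hx m) = G.presheaf.germ U x hx (φ.app U m) :=
  TopCat.Presheaf.stalkFunctor_map_germ_apply U x hx φ.mapPresheaf m

theorem stalkHom_comp (φ : F ⟶ G) (ψ : G ⟶ H) (x : X) :
    stalkHom (φ ≫ ψ) x = stalkHom ψ x ∘ₗ stalkHom φ x := by
  ext z
  obtain ⟨U, hx, m, rfl⟩ := F.presheaf.exists_germ_eq z
  simp only [LinearMap.comp_apply, stalkHom_germ, Hom.comp_app]
  rfl

theorem stalkHom_id (x : X) : stalkHom (𝟙 F) x = LinearMap.id := by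
  ext z
  obtain ⟨U, hx, m, rfl⟩ := F.presheaf.exists_germ_eq z
  rw [stalkHom_germ]
  rfl

theorem stalkHom_zero (x : X) : stalkHom (0 : F ⟶ G) x = 0 := by
  ext z
  obtain ⟨U, hx, m, rfl⟩ := F.presheaf.exists_germ_eq z
  rw [stalkHom_germ, Hom.zero_app]
  exact map_zero _

theorem stalkHom_add (φ ψ : F ⟶ G) (x : X) : stalkHom (φ + ψ) x = stalkHom φ x + stalkHom ψ x := by
  ext z
  obtain ⟨U, hx, m, rfl⟩ := F.presheaf.exists_germ_eq z
  rw [LinearMap.add_apply, stalkHom_germ, stalkHom_germ, stalkHom_germ, Hom.add_app]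
  exact map_add _ _ _

theorem stalkHom_sum {ι : Type*} (s : Finset ι) (φ : ι → (F ⟶ G)) (x : X) :
    stalkHom (∑ i ∈ s, φ i) x = ∑ i ∈ s, stalkHom (φ i) x := by
  classical
  induction s using Finset.induction_on with
  | empty => simp [stalkHom_zero]
  | insert a s ha ih => rw [Finset.sum_insert ha, Finset.sum_insert ha, stalkHom_add, ih]

/-- The specialization map on the stalks of a sheaf of modules. -/
def specMap (F : X.Modules) {ξ x : X} (h : ξ ⤳ x) : Stalk F x →+ Stalk F ξ :=
  (F.presheaf.stalkSpecializes h).hom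

theorem specMap_germ (F : X.Modules) {ξ x : X} (h : ξ ⤳ x) {U : X.Opens} (hx : x ∈ U)
    (m : Γ(F, U)) : specMap F h (F.presheaf.germ U x hx m) =
      F.presheaf.germ U ξ (h.mem_open U.2 hx) m :=
  TopCat.Presheaf.germ_stalkSpecializes_apply F.presheaf hx h m

theorem specMap_smul (F : X.Modules) {ξ x : X} (h : ξ ⤳ x) (r : X.presheaf.stalk x)
    (z : Stalk F x) : specMap F h (r • z) = X.presheaf.stalkSpecializes h r • specMap F h z := by
  obtain ⟨U, hx, a, m, rfl, rfl⟩ := exists_germ_pair r z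
  rw [← germ_smul, specMap_germ, germ_smul, specMap_germ]
  congr 1
  exact (TopCat.Presheaf.germ_stalkSpecializes_apply X.presheaf hx h a).symm

theorem stalkHom_specMap (φ : F ⟶ G) {ξ x : X} (h : ξ ⤳ x) (z : Stalk F x) :
    stalkHom φ ξ (specMap F h z) = specMap G h (stalkHom φ x z) := by
  obtain ⟨U, hx, m, rfl⟩ := F.presheaf.exists_germ_eq z
  rw [specMap_germ, stalkHom_germ, stalkHom_germ, specMap_germ]

theorem isUnit_germ_of_mem_basicOpen {W : X.Opens} {a : Γ(X, W)} {y : X} (hy : y ∈ W)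
    (h : y ∈ X.basicOpen a) : IsUnit (X.presheaf.germ W y hy a) :=
  (X.mem_basicOpen a y hy).mp h

theorem germ_mem_maximalIdeal_iff {W : X.Opens} {a : Γ(X, W)} {y : X} (hy : y ∈ W) :
    X.presheaf.germ W y hy a ∈ IsLocalRing.maximalIdeal (X.presheaf.stalk y) ↔
      y ∉ X.basicOpen a := by
  rw [IsLocalRing.mem_maximalIdeal, mem_nonunits_iff, X.mem_basicOpen a y hy]

variable {W : X.Opens}

/-- A coherent sheaf is generated near `x` by sections, hence the stalk at a generization of `x`
is generated by the image of the stalk at `x`. -/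
theorem IsCoherent.exists_smul_eq_specMap (hF : IsCoherent F) {ξ x : X} (h : ξ ⤳ x)
    (z : Stalk F ξ) : ∃ (u : X.presheaf.stalk ξ) (w : Stalk F x), IsUnit u ∧
      u • z = specMap F h w := by
  obtain ⟨W, hx, hW⟩ := hF.exists_isChart x
  have hξ : ξ ∈ W := h.mem_open W.2 hx
  obtain ⟨a, m, ha, hm⟩ := hW.surj ξ hξ z
  exact ⟨_, F.presheaf.germ W x hx m, isUnit_germ_of_mem_basicOpen hξ ha, by
    rw [hm, specMap_germ]⟩

/-- Equality of two morphisms on stalks passes to generizations. -/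
theorem IsCoherent.stalkHom_eq_of_specializes (hF : IsCoherent F) {φ ψ : F ⟶ G} {ξ x : X}
    (h : ξ ⤳ x) (hφ : stalkHom φ x = stalkHom ψ x) : stalkHom φ ξ = stalkHom ψ ξ := by
  ext z
  obtain ⟨u, w, hu, huw⟩ := hF.exists_smul_eq_specMap h z
  rw [← hu.smul_left_cancel, ← LinearMap.map_smul, ← LinearMap.map_smul, huw, stalkHom_specMap,
    stalkHom_specMap, hφ]

theorem IsCoherent.finite_stalk (hF : IsCoherent F) (x : X) :
    Module.Finite (X.presheaf.stalk x) (Stalk F x) := by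
  obtain ⟨W, hx, hW⟩ := hF.exists_isChart x
  obtain ⟨s, hs⟩ := hW.finite.fg_top
  refine ⟨Submodule.fg_def.mpr ⟨F.presheaf.germ W x hx '' s, s.finite_toSet.image _, ?_⟩⟩
  have key : ∀ m : Γ(F, W), m ∈ Submodule.span Γ(X, W) (s : Set Γ(F, W)) →
      F.presheaf.germ W x hx m ∈
        Submodule.span (X.presheaf.stalk x) (F.presheaf.germ W x hx '' s : Set (Stalk F x)) := by
    intro m hm
    induction hm using Submodule.span_induction with
    | mem m hm => exact Submodule.subset_span ⟨m, hm, rfl⟩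
    | zero => rw [map_zero]; exact Submodule.zero_mem _
    | add m n _ _ hm hn => rw [map_add]; exact Submodule.add_mem _ hm hn
    | smul r m _ hm => rw [germ_smul]; exact Submodule.smul_mem _ _ hm
  rw [eq_top_iff]
  intro z _
  obtain ⟨a, m, ha, hm⟩ := hW.surj x hx z
  obtain ⟨u, hu⟩ := isUnit_germ_of_mem_basicOpen hx ha
  have : z = (↑u⁻¹ : X.presheaf.stalk x) • (F.presheaf.germ W x hx m : Stalk F x) := by
    rw [← hm, ← hu, ← mul_smul, Units.inv_mul, one_smul]
  rw [this]
  exact Submodule.smul_mem _ _ (key m (hs ▸ Submodule.mem_top))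

theorem IsCoherent.isClosed_supp (hF : IsCoherent F) : IsClosed (Supp F) := by
  rw [← isOpen_compl_iff, isOpen_iff_forall_mem_open]
  intro x hx
  replace hx : Subsingleton (Stalk F x) := not_nontrivial_iff_subsingleton.mp hx
  obtain ⟨W, hxW, hW⟩ := hF.exists_isChart x
  obtain ⟨s, hs⟩ := hW.finite.fg_top
  have h : ∀ m : s, ∃ a : Γ(X, W), x ∈ X.basicOpen a ∧ a • (m : Γ(F, W)) = 0 :=
    fun m => hW.inj x hxW m (Subsingleton.elim (α := Stalk F x) _ _)
  choose a hxa ham using h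
  refine ⟨X.basicOpen (∏ m : s, a m), fun y hy => ?_, (X.basicOpen _).2, ?_⟩
  · have hyW : y ∈ W := X.basicOpen_le _ hy
    refine not_nontrivial_iff_subsingleton.mpr (subsingleton_of_forall_eq 0 fun z => ?_)
    have hzero : ∀ m : Γ(F, W), (∏ m : s, a m) • m = 0 := by
      intro m
      have hm : m ∈ Submodule.span Γ(X, W) (s : Set Γ(F, W)) := hs ▸ Submodule.mem_top
      induction hm using Submodule.span_induction with
      | mem m hm =>
        obtain ⟨c, hc⟩ := Finset.dvd_prod_of_mem a (Finset.mem_univ ⟨m, hm⟩)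
        rw [hc, mul_comm, mul_smul, ham ⟨m, hm⟩, smul_zero]
      | zero => simp
      | add m n _ _ hm hn => rw [smul_add, hm, hn, add_zero]
      | smul r m _ hm => rw [smul_comm, hm, smul_zero]
    obtain ⟨b, m, hb, hm⟩ := hW.surj y hyW z
    rw [← (isUnit_germ_of_mem_basicOpen hyW hb).smul_eq_zero, hm,
      ← (isUnit_germ_of_mem_basicOpen hyW hy).smul_eq_zero
        (x := (F.presheaf.germ W y hyW m : Stalk F y)),
      ← germ_smul, hzero, map_zero]
  · rw [SetLike.mem_coe, X.mem_basicOpen _ x hxW, map_prod]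
    exact IsUnit.prod_univ_iff.mpr fun m => isUnit_germ_of_mem_basicOpen hxW (hxa m)

/-- Every prime of the ring of functions of an affine open subset is the prime of a point. -/
theorem _root_.AlgebraicGeometry.IsAffineOpen.exists_mem_basicOpen_iff_notMem
    (hW : IsAffineOpen W) (P : Ideal Γ(X, W)) (hP : P.IsPrime) :
    ∃ y ∈ W, ∀ a : Γ(X, W), y ∈ X.basicOpen a ↔ a ∉ P := by
  refine ⟨hW.fromSpec ⟨P, hP⟩, ?_, fun a => ?_⟩
  · have := Set.mem_range_self (f := hW.fromSpec) ⟨P, hP⟩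
    rwa [hW.range_fromSpec] at this
  · have h := hW.fromSpec_preimage_basicOpen a
    have : (⟨P, hP⟩ : PrimeSpectrum Γ(X, W)) ∈ hW.fromSpec ⁻¹ᵁ X.basicOpen a ↔
      (⟨P, hP⟩ : PrimeSpectrum Γ(X, W)) ∈ PrimeSpectrum.basicOpen a := by rw [h]; exact Iff.rfl
    exact this

/-- The local ring at a point of an affine open subset consists of fractions of functions. -/
theorem _root_.AlgebraicGeometry.IsAffineOpen.exists_germ_mul_eq (hW : IsAffineOpen W) {y : X}
    (hy : y ∈ W) (α : X.presheaf.stalk y) : ∃ c a : Γ(X, W), y ∈ X.basicOpen c ∧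
      X.presheaf.germ W y hy c * α = X.presheaf.germ W y hy a := by
  let := X.presheaf.algebra_section_stalk ⟨y, hy⟩
  have := hW.isLocalization_stalk ⟨y, hy⟩
  obtain ⟨⟨a, c⟩, h⟩ := IsLocalization.surj (M := (hW.primeIdealOf ⟨y, hy⟩).asIdeal.primeCompl)
    (S := X.presheaf.stalk y) α
  refine ⟨c, a, ?_, by rw [mul_comm]; exact h⟩
  rw [X.mem_basicOpen _ y hy]
  exact IsLocalization.map_units (M := (hW.primeIdealOf ⟨y, hy⟩).asIdeal.primeCompl)
    (X.presheaf.stalk y) c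

/-- An element regular on the stalk can be taken to be the germ of a function on the chart. -/
theorem IsChart.exists_of_one_le_depth (hW : IsChart F W) {y : X} (hy : y ∈ W)
    (hd : 1 ≤ depth (X.presheaf.stalk y) (Stalk F y)) :
    ∃ a : Γ(X, W), y ∉ X.basicOpen a ∧ ∀ m : Γ(F, W), F.presheaf.germ W y hy (a • m) = 0 →
      F.presheaf.germ W y hy m = 0 := by
  obtain ⟨α, hα, hreg⟩ := exists_isSMulRegular_of_one_le_depth hd
  obtain ⟨c, a, hc, hca⟩ := hW.isAffineOpen.exists_germ_mul_eq hy α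
  refine ⟨a, ?_, fun m hm => ?_⟩
  · rw [← germ_mem_maximalIdeal_iff hy, ← hca]
    exact Ideal.mul_mem_left _ _ hα
  · rw [germ_smul, ← hca, mul_smul, (isUnit_germ_of_mem_basicOpen hy hc).smul_eq_zero] at hm
    exact hreg.right_eq_zero_of_smul hm

/-- A regular pair on the stalk can be taken to consist of germs of functions on the chart, and its
regularity then holds on sections up to denominators invertible at `y`; this is the hypothesis of
`powTorsion_sup_powTorsion_eq_top`. -/
theorem IsChart.exists_of_two_le_depth (hW : IsChart F W) {y : X} (hy : y ∈ W)
    (hd : 2 ≤ depth (X.presheaf.stalk y) (Stalk F y)) :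
    ∃ a b : Γ(X, W), y ∉ X.basicOpen a ∧ y ∉ X.basicOpen b ∧
      (∀ m : Γ(F, W), a • m = 0 → ∃ h : Γ(X, W), y ∈ X.basicOpen h ∧ h • m = 0) ∧
      ∀ m m' : Γ(F, W), b • m = a • m' → ∃ g : Γ(X, W), y ∈ X.basicOpen g ∧
        ∃ w : Γ(F, W), g • m = a • w := by
  obtain ⟨α, hα, β, hβ, hreg, hreg'⟩ := exists_isRegular_pair_of_two_le_depth hd
  obtain ⟨c, a, hc, hca⟩ := hW.isAffineOpen.exists_germ_mul_eq hy α
  obtain ⟨d, b, hd, hdb⟩ := hW.isAffineOpen.exists_germ_mul_eq hy β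
  have huc := isUnit_germ_of_mem_basicOpen hy hc
  have hud := isUnit_germ_of_mem_basicOpen hy hd
  refine ⟨a, b, ?_, ?_, fun m hm => ?_, fun m m' hm => ?_⟩
  · rw [← germ_mem_maximalIdeal_iff hy, ← hca]
    exact Ideal.mul_mem_left _ _ hα
  · rw [← germ_mem_maximalIdeal_iff hy, ← hdb]
    exact Ideal.mul_mem_left _ _ hβ
  · refine hW.inj y hy m ?_
    have : F.presheaf.germ W y hy (a • m) = 0 := by rw [hm, map_zero]
    rw [germ_smul, ← hca, mul_smul, huc.smul_eq_zero] at this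
    exact hreg.right_eq_zero_of_smul this
  · have h1 := congr(F.presheaf.germ W y hy $hm)
    rw [germ_smul, germ_smul, ← hca, ← hdb, mul_comm, mul_smul, mul_comm, mul_smul] at h1
    obtain ⟨w, hw⟩ := hreg' _ _ h1
    obtain ⟨u, hu⟩ := hud
    obtain ⟨v, hv⟩ := huc
    -- the germ of `m` is a multiple of the germ of `a`
    have h2 : (F.presheaf.germ W y hy m : Stalk F y) = X.presheaf.germ W y hy a •
        ((↑u⁻¹ * ↑v⁻¹ : X.presheaf.stalk y) • w) := by
      rw [← hu] at hw
      rw [← hca, ← hv, ← mul_smul, show (v : X.presheaf.stalk y) * α * (↑u⁻¹ * ↑v⁻¹) =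
        ↑u⁻¹ * α * (↑v * ↑v⁻¹) by ring, Units.mul_inv, mul_one, mul_smul, ← hw, ← mul_smul,
        Units.inv_mul, one_smul]
    obtain ⟨g, w', hg, hgw⟩ := hW.surj y hy ((↑u⁻¹ * ↑v⁻¹ : X.presheaf.stalk y) • w)
    have h3 : F.presheaf.germ W y hy (g • m - a • w') = 0 := by
      rw [map_sub, germ_smul, germ_smul, h2, ← hgw, smul_comm, sub_self]
    obtain ⟨h, hh, hz⟩ := hW.inj y hy _ h3
    refine ⟨h * g, ?_, h • w', ?_⟩
    · rw [X.basicOpen_mul]; exact ⟨hh, hg⟩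
    · rw [smul_sub, sub_eq_zero] at hz
      rw [mul_smul, hz, smul_comm]

end Stalks

/-! ### The part of a section supported in a closed subset -/

section Extension

variable {X : Scheme.{u}} {F G : X.Modules}

theorem specializes_of_forall_mem_basicOpen {W : X.Opens} (hW : IsAffineOpen W) {ξ x : X}
    (hx : x ∈ W) (h : ∀ a : Γ(X, W), x ∈ X.basicOpen a → ξ ∈ X.basicOpen a) : ξ ⤳ x := by
  rw [specializes_iff_forall_open]
  intro U hU hxU
  obtain ⟨a, ha, hxa⟩ := hW.exists_basicOpen_le (V := ⟨U, hU⟩) ⟨x, hxU⟩ hx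
  exact ha (h a hxa)

/-- A section of a coherent sheaf is determined by its germs at the points where the sheaf has depth
zero. If the germ at `x` is nonzero, an associated prime of the submodule it generates is given by
a generization `y` of `x` at which the germ of the section is nonzero and the depth is zero. -/
theorem IsCoherent.eq_zero_of_germ_eq_zero [IsLocallyNoetherian X] (hF : IsCoherent F)
    {V : X.Opens} (s : Γ(F, V)) (hs : ∀ (ξ : X) (hξ : ξ ∈ V),
      ¬ 1 ≤ depth (X.presheaf.stalk ξ) (Stalk F ξ) → F.presheaf.germ V ξ hξ s = 0) : s = 0 := by
  refine TopCat.Presheaf.section_ext ⟨F.presheaf, F.isSheaf⟩ V _ _ fun x hx => ?_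
  refine Eq.trans ?_ (map_zero (F.presheaf.germ V x hx).hom).symm
  change F.presheaf.germ V x hx s = 0
  by_contra hne
  obtain ⟨W, hxW, hW⟩ := hF.exists_isChart x
  have := hW.finite
  have : IsNoetherianRing Γ(X, W) := IsLocallyNoetherian.component_noetherian ⟨W, hW.isAffineOpen⟩
  obtain ⟨a, m, ha, hm⟩ := hW.surj x hxW (F.presheaf.germ V x hx s)
  have hmne : F.presheaf.germ W x hxW m ≠ 0 := by
    rw [← hm, Ne, (isUnit_germ_of_mem_basicOpen hxW ha).smul_eq_zero]
    exact hne
  -- the sections whose germ at `x` vanishes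
  let K : Submodule Γ(X, W) Γ(F, W) :=
    { carrier := {n | F.presheaf.germ W x hxW n = 0}
      zero_mem' := map_zero _
      add_mem' := fun {p q} hp hq => by
        rw [Set.mem_ofPred_eq, map_add, hp, hq, add_zero]
      smul_mem' := fun r p hp => by
        rw [Set.mem_ofPred_eq, germ_smul, hp]
        exact smul_zero (A := Stalk F x) _ }
  have hKmem : ∀ n, n ∈ K ↔ F.presheaf.germ W x hxW n = 0 := fun n => Iff.rfl
  obtain ⟨P, r, hP, hPr⟩ := exists_smul_annihilator_isPrime (R := Γ(X, W)) (x := K.mkQ m)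
    (by simpa [hKmem] using hmne)
  replace hPr : ∀ c, c ∈ P ↔ F.presheaf.germ W x hxW (c • r • m) = 0 := fun c => by
    rw [hPr, ← LinearMap.map_smul, ← LinearMap.map_smul, Submodule.mkQ_apply,
      Submodule.Quotient.mk_eq_zero, hKmem]
  have hrm : F.presheaf.germ W x hxW (r • m) ≠ 0 := fun h => hP.ne_top <|
    P.eq_top_iff_one.mpr ((hPr 1).mpr (by rwa [one_smul]))
  have hxP : ∀ c, x ∈ X.basicOpen c → c ∉ P := fun c hc hcP => hrm <| by
    have := (hPr c).mp hcP
    rwa [germ_smul, (isUnit_germ_of_mem_basicOpen hxW hc).smul_eq_zero] at this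
  obtain ⟨y, hyW, hyP⟩ := hW.isAffineOpen.exists_mem_basicOpen_iff_notMem P hP
  have hyx : y ⤳ x := specializes_of_forall_mem_basicOpen hW.isAffineOpen hxW fun c hc =>
    (hyP c).mpr (hxP c hc)
  -- one function, invertible at `x`, kills all sections whose germ at `x` vanishes
  obtain ⟨h, hhP, hhK⟩ := exists_notMem_smul_eq_zero hP K fun n hn => by
    obtain ⟨c, hc, hcn⟩ := hW.inj x hxW n hn
    exact ⟨c, hxP c hc, hcn⟩
  have hy_ne : F.presheaf.germ W y hyW (h • r • m) ≠ 0 := by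
    intro h0
    obtain ⟨c, hc, hcm⟩ := hW.inj y hyW _ h0
    have h1 : c * h ∈ P := by
      rw [hPr, mul_smul, hcm, map_zero]
    exact (hP.mem_or_mem h1).elim ((hyP c).mp hc) hhP
  have hdepth : ¬ 1 ≤ depth (X.presheaf.stalk y) (Stalk F y) := by
    intro hd
    obtain ⟨c, hc, hreg⟩ := hW.exists_of_one_le_depth hyW hd
    refine hy_ne (hreg _ ?_)
    have hcP : c ∈ P := not_not.mp (mt (hyP c).mpr hc)
    rw [smul_comm, hhK _ ((hKmem _).mpr ((hPr c).mp hcP)), map_zero]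
  have h0 := hs y (hyx.mem_open V.2 hx) hdepth
  have h1 : F.presheaf.germ W y hyW m = 0 := by
    rw [← specMap_germ F hyx hxW, ← hm, specMap_smul, specMap_germ, h0]
    exact smul_zero (A := Stalk F y) _
  refine hy_ne ?_
  rw [germ_smul, germ_smul, h1]
  exact (congrArg _ (smul_zero (A := Stalk F y) _)).trans (smul_zero (A := Stalk F y) _)

theorem IsCoherent.hom_ext_of_depth [IsLocallyNoetherian X] (hF : IsCoherent F) {φ ψ : G ⟶ F}
    (h : ∀ ξ, ¬ 1 ≤ depth (X.presheaf.stalk ξ) (Stalk F ξ) → stalkHom φ ξ = stalkHom ψ ξ) :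
    φ = ψ := by
  ext U m
  rw [← sub_eq_zero]
  refine hF.eq_zero_of_germ_eq_zero _ fun ξ hξ hd => ?_
  rw [map_sub, sub_eq_zero]
  refine (stalkHom_germ φ hξ m).symm.trans (Eq.trans ?_ (stalkHom_germ ψ hξ m))
  rw [h ξ hd]

/-- The functions on `W` vanishing at all points of `S`. -/
def vanishingIdeal (W : X.Opens) (S : Set X) : Ideal Γ(X, W) where
  carrier := {a | ∀ y ∈ S, y ∉ X.basicOpen a}
  zero_mem' y _ := by simp
  add_mem' := by
    intro a b ha hb y hyS hy
    have hyW := X.basicOpen_le _ hy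
    rw [← not_not (a := y ∈ X.basicOpen (a + b)), ← germ_mem_maximalIdeal_iff hyW, map_add] at hy
    exact hy (Ideal.add_mem _ ((germ_mem_maximalIdeal_iff hyW).mpr (ha y hyS))
      ((germ_mem_maximalIdeal_iff hyW).mpr (hb y hyS)))
  smul_mem' := by
    intro r a ha y hyS hy
    rw [smul_eq_mul, X.basicOpen_mul] at hy
    exact ha y hyS hy.2

theorem exists_mem_vanishingIdeal {W : X.Opens} (hW : IsAffineOpen W) {S : Set X}
    (hS : IsClosed S) {y : X} (hyW : y ∈ W) (hyS : y ∉ S) :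
    ∃ a ∈ vanishingIdeal W S, y ∈ X.basicOpen a := by
  obtain ⟨a, ha, hya⟩ := hW.exists_basicOpen_le (V := ⟨Sᶜ, hS.isOpen_compl⟩) ⟨y, hyS⟩ hyW
  exact ⟨a, fun z hz hza => ha hza hz, hya⟩

theorem germ_eq_zero_of_mem_powTorsion {W : X.Opens} (hW : IsAffineOpen W) {S : Set X}
    (hS : IsClosed S) {y : X} (hyW : y ∈ W) (hyS : y ∉ S) {u : Γ(F, W)}
    (hu : u ∈ powTorsion Γ(F, W) (vanishingIdeal W S)) : F.presheaf.germ W y hyW u = 0 := by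
  obtain ⟨k, hk⟩ := hu
  obtain ⟨a, ha, hya⟩ := exists_mem_vanishingIdeal hW hS hyW hyS
  have := hk _ (Ideal.pow_mem_pow ha k)
  have h1 : F.presheaf.germ W y hyW (a ^ k • u) = 0 := by rw [this, map_zero]
  rwa [germ_smul, map_pow, ((isUnit_germ_of_mem_basicOpen hyW hya).pow k).smul_eq_zero] at h1

variable {S T : Set X}

/-- On a chart, every section is the sum of one supported in `S` and one supported in `T`. -/
theorem IsChart.powTorsion_sup_eq_top [IsLocallyNoetherian X] {W : X.Opens} (hW : IsChart F W)
    (hS : IsClosed S) (hT : IsClosed T) (hST : Supp F ⊆ S ∪ T)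
    (hd : ∀ x ∈ S ∩ T, 2 ≤ depth (X.presheaf.stalk x) (Stalk F x)) :
    powTorsion Γ(F, W) (vanishingIdeal W S) ⊔ powTorsion Γ(F, W) (vanishingIdeal W T) = ⊤ := by
  have := hW.finite
  have : IsNoetherianRing Γ(X, W) := IsLocallyNoetherian.component_noetherian ⟨W, hW.isAffineOpen⟩
  have hrad : vanishingIdeal W S * vanishingIdeal W T ≤
      (Module.annihilator Γ(X, W) Γ(F, W)).radical := by
    rw [Ideal.radical_eq_sInf]
    refine le_sInf fun P ⟨hPann, hP⟩ => ?_
    obtain ⟨y, hyW, hyP⟩ := hW.isAffineOpen.exists_mem_basicOpen_iff_notMem P hP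
    have hy : y ∈ Supp F := by
      by_contra hy
      replace hy : Subsingleton (Stalk F y) := not_nontrivial_iff_subsingleton.mp hy
      obtain ⟨g, hg, hg'⟩ := exists_notMem_smul_eq_zero hP (⊤ : Submodule Γ(X, W) Γ(F, W))
        fun m _ => by
          obtain ⟨c, hc, hcm⟩ := hW.inj y hyW m (Subsingleton.elim (α := Stalk F y) _ _)
          exact ⟨c, (hyP c).mp hc, hcm⟩
      exact hg (hPann (Module.mem_annihilator.mpr fun m => hg' m trivial))
    rcases hST hy with h | h
    · exact Ideal.mul_le_left.trans fun a ha => not_not.mp (mt (hyP a).mpr (ha y h))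
    · exact Ideal.mul_le_right.trans fun a ha => not_not.mp (mt (hyP a).mpr (ha y h))
  obtain ⟨n, hn⟩ := Ideal.exists_pow_le_of_le_radical_of_fg hrad (IsNoetherian.noetherian _)
  refine powTorsion_sup_powTorsion_eq_top _ _ (n := n)
    (fun c hc m => Module.mem_annihilator.mp (hn hc) m) fun P hP hSP hTP => ?_
  obtain ⟨y, hyW, hyP⟩ := hW.isAffineOpen.exists_mem_basicOpen_iff_notMem P hP
  have hmem : ∀ Z : Set X, IsClosed Z → vanishingIdeal W Z ≤ P → y ∈ Z := by
    intro Z hZ hZP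
    by_contra hy
    obtain ⟨a, ha, hya⟩ := exists_mem_vanishingIdeal hW.isAffineOpen hZ hyW hy
    exact (hyP a).mp hya (hZP ha)
  obtain ⟨a, b, ha, hb, h1, h2⟩ := hW.exists_of_two_le_depth hyW
    (hd y ⟨hmem S hS hSP, hmem T hT hTP⟩)
  refine ⟨a, not_not.mp (mt (hyP a).mpr ha), b, not_not.mp (mt (hyP b).mpr hb), fun m hm => ?_,
    fun m m' hm => ?_⟩
  · obtain ⟨h, hh, hhm⟩ := h1 m hm
    exact ⟨h, (hyP h).mp hh, hhm⟩
  · obtain ⟨g, hg, w, hw⟩ := h2 m m' hm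
    exact ⟨g, (hyP g).mp hg, w, hw⟩

/-- The section `t` is the part of `s` supported in `S`: it agrees with `s` off `T` and vanishes
off `S`, at all points where both sections are defined. -/
def IsPart (S T : Set X) {V V' : X.Opens} (s : Γ(F, V)) (t : Γ(F, V')) : Prop :=
  ∀ (y : X) (hy : y ∈ V) (hy' : y ∈ V'),
    (y ∉ T → F.presheaf.germ V' y hy' t = F.presheaf.germ V y hy s) ∧
    (y ∉ S → F.presheaf.germ V' y hy' t = 0)

/-- The part supported in `S` is unique: two of them agree outside `S ∩ T`, where all points of
depth zero lie. -/
theorem IsPart.eq [IsLocallyNoetherian X] (hF : IsCoherent F)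
    (hd : ∀ x ∈ S ∩ T, 2 ≤ depth (X.presheaf.stalk x) (Stalk F x)) {V V' : X.Opens}
    (h : V' ≤ V) {s : Γ(F, V)} {t t' : Γ(F, V')} (ht : IsPart S T s t) (ht' : IsPart S T s t') :
    t = t' := by
  rw [← sub_eq_zero]
  refine hF.eq_zero_of_germ_eq_zero _ fun y hy hdy => ?_
  rw [map_sub, sub_eq_zero]
  by_cases hyT : y ∈ T
  · by_cases hyS : y ∈ S
    · exact absurd (le_trans one_le_two (hd y ⟨hyS, hyT⟩)) hdy
    · rw [(ht y (h hy) hy).2 hyS, (ht' y (h hy) hy).2 hyS]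
  · rw [(ht y (h hy) hy).1 hyT, (ht' y (h hy) hy).1 hyT]

theorem IsPart.res {V V' V'' : X.Opens} {s : Γ(F, V)} {t : Γ(F, V')} (ht : IsPart S T s t)
    (h : V'' ≤ V') : IsPart S T s (F.presheaf.map (homOfLE h).op t) := fun y hy hy' => by
  rw [germ_res]
  exact ht y hy (h hy')

/-- Near each point the part of `s` supported in `S` exists: clear the denominator `a` of the germ,
split the resulting section of the chart, and divide by `a` again. -/
theorem exists_isPart_nhds [IsLocallyNoetherian X] (hF : IsCoherent F)
    (hS : IsClosed S) (hT : IsClosed T) (hST : Supp F ⊆ S ∪ T)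
    (hd : ∀ x ∈ S ∩ T, 2 ≤ depth (X.presheaf.stalk x) (Stalk F x)) {V : X.Opens} (s : Γ(F, V))
    {x : X} (hx : x ∈ V) :
    ∃ (V' : X.Opens) (_ : x ∈ V') (_ : V' ≤ V) (t : Γ(F, V')), IsPart S T s t := by
  obtain ⟨W, hxW, hW⟩ := hF.exists_isChart x
  obtain ⟨a, m, ha, hm⟩ := hW.surj x hxW (F.presheaf.germ V x hx s)
  obtain ⟨u, hu, v, hv, huv⟩ := Submodule.mem_sup.mp
    ((hW.powTorsion_sup_eq_top hS hT hST hd).symm ▸ Submodule.mem_top : m ∈ _)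
  let B : X.Opens := X.basicOpen a ⊓ V
  have hBW : B ≤ W := inf_le_left.trans (X.basicOpen_le a)
  have hBV : B ≤ V := inf_le_right
  have hxB : x ∈ B := ⟨ha, hx⟩
  have hgerm : F.presheaf.germ B x hxB (X.presheaf.map (homOfLE hBW).op a •
      F.presheaf.map (homOfLE hBV).op s) =
      F.presheaf.germ B x hxB (F.presheaf.map (homOfLE hBW).op m) := by
    rw [germ_smul, germ_res, germ_res]
    exact (congrArg (fun c : X.presheaf.stalk x => c • (F.presheaf.germ V x hx s : Stalk F x))
      (TopCat.Presheaf.germ_res_apply X.presheaf (homOfLE hBW) x hxB a)).trans hm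
  obtain ⟨V', hxV', i, i', hV'⟩ := F.presheaf.germ_eq x hxB hxB _ _ hgerm
  have hV'B : V' ≤ B := leOfHom i
  have hunit : IsUnit (X.presheaf.map (homOfLE (hV'B.trans hBW)).op a) := by
    have h1 := RingedSpace.isUnit_res_basicOpen X.toRingedSpace a
    have h2 := h1.map (X.presheaf.map
      (homOfLE (hV'B.trans inf_le_left : V' ≤ X.basicOpen a)).op).hom
    convert! h2 using 1
    exact congr($(X.presheaf.map_comp (homOfLE (X.basicOpen_le a)).op
      (homOfLE (hV'B.trans inf_le_left : V' ≤ X.basicOpen a)).op) a)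
  obtain ⟨c, hc⟩ := hunit
  refine ⟨V', hxV', hV'B.trans hBV,
    (↑c⁻¹ : Γ(X, V')) • F.presheaf.map (homOfLE (hV'B.trans hBW)).op u, fun y hy hy' => ?_⟩
  have hyW : y ∈ W := hBW (hV'B hy')
  have hya := isUnit_germ_of_mem_basicOpen hyW (hV'B hy').1
  have hcy : X.presheaf.germ V' y hy' c = X.presheaf.germ W y hyW a := by
    rw [hc]
    exact TopCat.Presheaf.germ_res_apply X.presheaf (homOfLE (hV'B.trans hBW)) y hy' a
  have h1 : X.presheaf.germ W y hyW a • (F.presheaf.germ V' y hy'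
      ((↑c⁻¹ : Γ(X, V')) • F.presheaf.map (homOfLE (hV'B.trans hBW)).op u) : Stalk F y) =
      F.presheaf.germ W y hyW u := by
    rw [← hcy, ← germ_smul, ← mul_smul, Units.mul_inv, one_smul, germ_res]
  constructor
  · intro hyT
    have h2 : F.presheaf.germ W y hyW u = F.presheaf.germ W y hyW m := by
      rw [← huv, map_add, germ_eq_zero_of_mem_powTorsion hW.isAffineOpen hT hyW hyT hv, add_zero]
    have h3 : X.presheaf.germ W y hyW a • (F.presheaf.germ V y hy s : Stalk F y) =
        F.presheaf.germ W y hyW m := by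
      have := congr(F.presheaf.germ V' y hy' $hV')
      rw [TopCat.Presheaf.germ_res_apply, TopCat.Presheaf.germ_res_apply, germ_smul, germ_res,
        germ_res] at this
      refine Eq.trans ?_ this
      exact (congrArg (fun c : X.presheaf.stalk y => c • (F.presheaf.germ V y hy s : Stalk F y))
        (TopCat.Presheaf.germ_res_apply X.presheaf (homOfLE hBW) y (hV'B hy') a)).symm
    rw [h2, ← h3] at h1
    exact hya.smul_left_cancel.mp h1
  · intro hyS
    rw [germ_eq_zero_of_mem_powTorsion hW.isAffineOpen hS hyW hyS hu] at h1
    exact hya.smul_eq_zero.mp h1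

/-- The local parts glue, being unique. -/
theorem exists_isPart [IsLocallyNoetherian X] (hF : IsCoherent F)
    (hS : IsClosed S) (hT : IsClosed T) (hST : Supp F ⊆ S ∪ T)
    (hd : ∀ x ∈ S ∩ T, 2 ≤ depth (X.presheaf.stalk x) (Stalk F x)) {V : X.Opens} (s : Γ(F, V)) :
    ∃ t : Γ(F, V), IsPart S T s t := by
  have hloc := fun x : V => exists_isPart_nhds hF hS hT hST hd s x.2
  choose V' hx hV' t ht using hloc
  have hcompat : TopCat.Presheaf.IsCompatible F.presheaf V' t := fun x y =>
    IsPart.eq hF hd (inf_le_left.trans (hV' x)) ((ht x).res inf_le_left)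
      ((ht y).res inf_le_right)
  obtain ⟨t', ht', -⟩ := TopCat.Sheaf.existsUnique_gluing' ⟨F.presheaf, F.isSheaf⟩ V' V
    (fun x => homOfLE (hV' x)) (fun x hxV => Opens.mem_iSup.mpr ⟨⟨x, hxV⟩, hx _⟩) t hcompat
  refine ⟨t', fun y hy hy' => ?_⟩
  have h := ht ⟨y, hy⟩ y hy (hx _)
  rw [← ht' ⟨y, hy⟩] at h
  have hg := germ_res F (hV' ⟨y, hy⟩) y (hx _) t'
  exact ⟨fun hyT => hg.symm.trans (h.1 hyT), fun hyS => hg.symm.trans (h.2 hyS)⟩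

/-- Let `S` and `T` be closed subsets covering the support of `F` such that `F` has depth at least
two along `S ∩ T`. Then `F` splits into a part supported in `S` and a part supported in `T`; this
is the projection to the first one. -/
theorem exists_projection [IsLocallyNoetherian X] (hF : IsCoherent F)
    (hS : IsClosed S) (hT : IsClosed T) (hST : Supp F ⊆ S ∪ T)
    (hd : ∀ x ∈ S ∩ T, 2 ≤ depth (X.presheaf.stalk x) (Stalk F x)) :
    ∃ e : F ⟶ F, (∀ x ∉ T, stalkHom e x = LinearMap.id) ∧ ∀ x ∉ S, stalkHom e x = 0 := by
  choose p hp using fun (V : X.Opens) (s : Γ(F, V)) => exists_isPart hF hS hT hST hd s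
  have hp_eq : ∀ {V : X.Opens} {s t : Γ(F, V)}, IsPart S T s t → p V s = t :=
    fun ht => IsPart.eq hF hd le_rfl (hp _ _) ht
  have hadd : ∀ (V : X.Opens) (s t : Γ(F, V)), p V (s + t) = p V s + p V t := fun V s t =>
    hp_eq fun y hy hy' => by
      constructor
      · intro h
        rw [map_add, map_add, ((hp V s) y hy hy').1 h, ((hp V t) y hy hy').1 h]
      · intro h
        rw [map_add, ((hp V s) y hy hy').2 h, ((hp V t) y hy hy').2 h, add_zero]
  have hsmul : ∀ (V : X.Opens) (r : Γ(X, V)) (s : Γ(F, V)), p V (r • s) = r • p V s := fun V r s =>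
    hp_eq fun y hy hy' => by
      constructor
      · intro h
        rw [germ_smul, germ_smul, ((hp V s) y hy hy').1 h]
      · intro h
        rw [germ_smul, ((hp V s) y hy hy').2 h]
        exact smul_zero (A := Stalk F y) _
  have hres : ∀ (V V' : X.Opens) (h : V' ≤ V) (s : Γ(F, V)),
      p V' (F.presheaf.map (homOfLE h).op s) = F.presheaf.map (homOfLE h).op (p V s) :=
    fun V V' h s => hp_eq fun y hy hy' => by
      rw [germ_res, germ_res]
      exact hp V s y (h hy) (h hy')
  let φ : F.presheaf ⟶ F.presheaf :=
    { app V := AddCommGrpCat.ofHom (AddMonoidHom.mk' (p V.unop) (hadd V.unop))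
      naturality V V' i := by
        ext s
        exact hres V.unop V'.unop (leOfHom i.unop) s }
  let e : F ⟶ F := ⟨PresheafOfModules.homMk φ fun V r s => hsmul V.unop r s⟩
  have he : ∀ (V : X.Opens) (s : Γ(F, V)), e.app V s = p V s := fun V s => rfl
  refine ⟨e, fun x hx => ?_, fun x hx => ?_⟩
  · ext z
    obtain ⟨V, hxV, s, rfl⟩ := F.presheaf.exists_germ_eq z
    rw [stalkHom_germ, he]
    exact (hp V s x hxV hxV).1 hx
  · ext z
    obtain ⟨V, hxV, s, rfl⟩ := F.presheaf.exists_germ_eq z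
    rw [stalkHom_germ, he]
    exact (hp V s x hxV hxV).2 hx

end Extension

/-! ### Generic points and connected components in codimension one -/

section Components

variable {Y : Type u} [TopologicalSpace Y]

/-- A point without proper generizations: the generic points of the irreducible components. -/
def IsGenericPt (ξ : Y) : Prop := ∀ η : Y, η ⤳ ξ → ξ ⤳ η

theorem exists_isGenericPt_closure_eq [QuasiSober Y] (C : irreducibleComponents Y) :
    ∃ ξ : Y, IsGenericPt ξ ∧ closure {ξ} = (C : Set Y) := by
  have hC : closure {C.2.prop.genericPoint} = (C : Set Y) :=
    C.2.prop.isGenericPoint_genericPoint (isClosed_of_mem_irreducibleComponents _ C.2)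
  refine ⟨C.2.prop.genericPoint, fun η hη => ?_, hC⟩
  rw [specializes_iff_closure_subset] at hη ⊢
  rw [hC] at hη ⊢
  exact C.2.le_of_ge isIrreducible_singleton.closure hη

theorem IsGenericPt.closure_mem [QuasiSober Y] {ξ : Y} (hξ : IsGenericPt ξ) :
    closure {ξ} ∈ irreducibleComponents Y := by
  obtain ⟨η, hη, hηC⟩ := exists_isGenericPt_closure_eq
    ⟨_, irreducibleComponent_mem_irreducibleComponents ξ⟩
  have h1 : η ⤳ ξ := by
    rw [specializes_iff_mem_closure, hηC]; exact mem_irreducibleComponent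
  rw [inseparable_iff_closure_eq.mp (h1.antisymm (hξ η h1))] at hηC
  rw [hηC]
  exact irreducibleComponent_mem_irreducibleComponents ξ

theorem codim_le_coheight {Z : Set Y} (W : IrreducibleCloseds Y) (h : (W : Set Y) ⊆ Z) :
    codim Z ≤ Order.coheight W :=
  iInf₂_le W h

theorem IsGenericPt.pointCodim_le [QuasiSober Y] {ξ : Y} (hξ : IsGenericPt ξ) (k : ℕ∞) :
    pointCodim ξ ≤ k := by
  refine (codim_le_coheight ⟨closure {ξ}, isIrreducible_singleton.closure,
    isClosed_closure⟩ subset_rfl).trans (le_of_eq_of_le ?_ (zero_le (a := k)))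
  rw [Order.coheight_eq_zero]
  intro V hV
  exact hξ.closure_mem.le_of_ge V.isIrreducible hV

/-- A subset of codimension at most one contains a point of codimension at most one. -/
theorem exists_pointCodim_le [QuasiSober Y] {Z : Set Y} (hZ : codim Z ≤ 1) :
    ∃ x ∈ Z, pointCodim x ≤ 1 := by
  have h : codim Z < 2 := lt_of_le_of_lt hZ (by norm_num)
  obtain ⟨W, hW⟩ := iInf_lt_iff.mp h
  obtain ⟨hWZ, hW⟩ := iInf_lt_iff.mp hW
  have hgen : closure {W.isIrreducible.genericPoint} = (W : Set Y) :=
    W.isIrreducible.isGenericPoint_genericPoint W.isClosed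
  refine ⟨W.isIrreducible.genericPoint,
    hWZ (hgen.le (subset_closure (Set.mem_singleton W.isIrreducible.genericPoint))), ?_⟩
  rw [pointCodim, hgen]
  refine (codim_le_coheight W subset_rfl).trans ?_
  rw [← one_add_one_eq_two] at hW
  exact ENat.lt_natCast_add_one_iff.mp hW

/-- A point `x` of a closed subset of codimension at least two admits a chain of two proper
generizations. -/
theorem exists_specializes_chain_of_lt_codim [QuasiSober Y] {Z : Set Y} (hZ : IsClosed Z)
    (hcodim : ¬ codim Z ≤ 1) {x : Y} (hx : x ∈ Z) :
    ∃ η₁ η₂ : Y, η₁ ⤳ x ∧ η₂ ⤳ η₁ ∧ ¬ x ⤳ η₁ ∧ ¬ η₁ ⤳ η₂ := by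
  let W : IrreducibleCloseds Y := ⟨closure {x}, isIrreducible_singleton.closure, isClosed_closure⟩
  have hWZ : (W : Set Y) ⊆ Z := closure_minimal (Set.singleton_subset_iff.mpr hx) hZ
  have h1 : codim Z ≤ Order.coheight W := codim_le_coheight W hWZ
  have h2 : ((2 : ℕ) : ℕ∞) ≤ Order.coheight W := by
    have : (1 : ℕ∞) < Order.coheight W := (not_le.mp hcodim).trans_le h1
    exact_mod_cast Order.add_one_le_of_lt this
  obtain ⟨p, hp, hl⟩ := Order.exists_series_of_le_coheight W h2
  have hlt : ∀ i j : Fin (p.length + 1), i < j → p i < p j := fun i j h => p.strictMono h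
  let i1 : Fin (p.length + 1) := ⟨1, by omega⟩
  let i2 : Fin (p.length + 1) := ⟨2, by omega⟩
  have h01 : W < p i1 := hp ▸ hlt 0 i1 (by simp [i1, Fin.lt_def])
  have h12 : p i1 < p i2 := hlt i1 i2 (by simp [i1, i2, Fin.lt_def])
  have hg : ∀ V : IrreducibleCloseds Y, closure {V.isIrreducible.genericPoint} = (V : Set Y) :=
    fun V => V.isIrreducible.isGenericPoint_genericPoint V.isClosed
  refine ⟨(p i1).isIrreducible.genericPoint, (p i2).isIrreducible.genericPoint, ?_, ?_, ?_, ?_⟩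
  · rw [specializes_iff_closure_subset, hg]; exact h01.le
  · rw [specializes_iff_closure_subset, hg, hg]; exact h12.le
  · rw [specializes_iff_closure_subset, hg]; exact h01.not_ge
  · rw [specializes_iff_closure_subset, hg, hg]; exact h12.not_ge

theorem adjacentInCodim_symm {k : ℕ∞} {C D : irreducibleComponents Y}
    (h : AdjacentInCodim k C D) : AdjacentInCodim k D C := by
  rw [AdjacentInCodim, Set.inter_comm]; exact h

theorem reflTransGen_adjacentInCodim_symm {k : ℕ∞} {C D : irreducibleComponents Y}
    (h : Relation.ReflTransGen (AdjacentInCodim k) C D) :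
    Relation.ReflTransGen (AdjacentInCodim k) D C := by
  induction h with
  | refl => exact .refl
  | tail _ h ih => exact .head (adjacentInCodim_symm h) ih

theorem mem_codimComponent {k : ℕ∞} {C : irreducibleComponents Y} {x : Y} :
    x ∈ codimComponent k C ↔ ∃ D : irreducibleComponents Y,
      Relation.ReflTransGen (AdjacentInCodim k) C D ∧ x ∈ (D : Set Y) := by
  simp [codimComponent]

theorem codimComponent_eq_of_reflTransGen {k : ℕ∞} {C D : irreducibleComponents Y}
    (h : Relation.ReflTransGen (AdjacentInCodim k) C D) :
    codimComponent k C = codimComponent k D := by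
  have h' := reflTransGen_adjacentInCodim_symm h
  ext x
  rw [mem_codimComponent, mem_codimComponent]
  exact exists_congr fun E => and_congr_left fun _ => ⟨h'.trans, h.trans⟩

theorem IsGenericPt.reflTransGen [QuasiSober Y] {k : ℕ∞} {C : irreducibleComponents Y} {ξ : Y}
    (hξ : IsGenericPt ξ) (h : ξ ∈ codimComponent k C) :
    Relation.ReflTransGen (AdjacentInCodim k) C ⟨closure {ξ}, hξ.closure_mem⟩ := by
  obtain ⟨D, hD, hξD⟩ := mem_codimComponent.mp h
  have : (⟨closure {ξ}, hξ.closure_mem⟩ : irreducibleComponents Y) = D := by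
    refine Subtype.ext (hξ.closure_mem.eq_of_le D.2.prop ?_)
    exact closure_minimal (Set.singleton_subset_iff.mpr hξD)
      (isClosed_of_mem_irreducibleComponents _ D.2)
  rwa [this]

/-- A generic point lies in only one connected component in codimension `k`. -/
theorem IsGenericPt.codimComponent_eq [QuasiSober Y] {k : ℕ∞} {C D : irreducibleComponents Y}
    {ξ : Y} (hξ : IsGenericPt ξ) (hC : ξ ∈ codimComponent k C) (hD : ξ ∈ codimComponent k D) :
    codimComponent k C = codimComponent k D :=
  (codimComponent_eq_of_reflTransGen (hξ.reflTransGen hC)).trans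
    (codimComponent_eq_of_reflTransGen (hξ.reflTransGen hD)).symm

theorem exists_isGenericPt_mem_codimComponent [QuasiSober Y] {k : ℕ∞}
    {C : irreducibleComponents Y} {x : Y} (hx : x ∈ codimComponent k C) :
    ∃ ξ ∈ codimComponent k C, IsGenericPt ξ ∧ ξ ⤳ x := by
  obtain ⟨D, hD, hxD⟩ := mem_codimComponent.mp hx
  obtain ⟨ξ, hξ, hξD⟩ := exists_isGenericPt_closure_eq D
  refine ⟨ξ, mem_codimComponent.mpr ⟨D, hD, hξD ▸ subset_closure rfl⟩, hξ, ?_⟩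
  rw [specializes_iff_mem_closure, hξD]
  exact hxD

theorem subset_codimComponent (k : ℕ∞) (C : irreducibleComponents Y) :
    (C : Set Y) ⊆ codimComponent k C :=
  fun _ hx => mem_codimComponent.mpr ⟨C, .refl, hx⟩

theorem isClosed_codimComponent [NoetherianSpace Y] (k : ℕ∞) (C : irreducibleComponents Y) :
    IsClosed (codimComponent k C) := by
  have : Finite (irreducibleComponents Y) := NoetherianSpace.finite_irreducibleComponents
  exact Set.Finite.isClosed_biUnion (Set.toFinite _)
    fun D _ => isClosed_of_mem_irreducibleComponents _ D.2

/-- A point common to two distinct connected components in codimension one lies in the intersection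
of two irreducible components which has codimension at least two. -/
theorem exists_chain_of_codimComponent_ne [QuasiSober Y] {C D : irreducibleComponents Y}
    (hne : codimComponent 1 C ≠ codimComponent 1 D) {x : Y} (hC : x ∈ codimComponent 1 C)
    (hD : x ∈ codimComponent 1 D) :
    ∃ η₁ η₂ : Y, η₁ ⤳ x ∧ η₂ ⤳ η₁ ∧ ¬ x ⤳ η₁ ∧ ¬ η₁ ⤳ η₂ := by
  obtain ⟨C', hC', hxC⟩ := mem_codimComponent.mp hC
  obtain ⟨D', hD', hxD⟩ := mem_codimComponent.mp hD
  refine exists_specializes_chain_of_lt_codim (Z := (C' : Set Y) ∩ D')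
    ((isClosed_of_mem_irreducibleComponents _ C'.2).inter
      (isClosed_of_mem_irreducibleComponents _ D'.2)) (fun h => hne ?_) ⟨hxC, hxD⟩
  exact (codimComponent_eq_of_reflTransGen (hC'.tail h)).trans
    (codimComponent_eq_of_reflTransGen hD').symm

/-- A property of generic points that propagates through the points of codimension at most one
is constant on the connected components in codimension one. -/
theorem IsGenericPt.induction_codimComponent [QuasiSober Y] {P : Y → Prop}
    (hP : ∀ x : Y, pointCodim x ≤ 1 → ∀ ξ ξ' : Y, IsGenericPt ξ → IsGenericPt ξ' → ξ ⤳ x →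
      ξ' ⤳ x → P ξ → P ξ') {C : irreducibleComponents Y} {ξ ξ' : Y} (hξ : IsGenericPt ξ)
    (hξ' : IsGenericPt ξ') (hC : ξ ∈ codimComponent 1 C) (hC' : ξ' ∈ codimComponent 1 C)
    (h : P ξ) : P ξ' := by
  have hrel := (reflTransGen_adjacentInCodim_symm (hξ.reflTransGen hC)).trans (hξ'.reflTransGen hC')
  have key : ∀ D : irreducibleComponents Y,
      Relation.ReflTransGen (AdjacentInCodim 1) ⟨closure {ξ}, hξ.closure_mem⟩ D →
      ∀ η, IsGenericPt η → closure {η} = (D : Set Y) → P η := by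
    intro D hD
    induction hD with
    | refl =>
      intro η hη hηD
      -- `ξ` and `η` have the same closure, and `ξ` itself has codimension zero
      refine hP ξ (hξ.pointCodim_le 1) ξ η hξ hη specializes_rfl ?_ h
      rw [specializes_iff_closure_subset, hηD]
    | @tail E D _ hadj ih =>
      intro η hη hηD
      obtain ⟨ζ, hζ, hζE⟩ := exists_isGenericPt_closure_eq E
      obtain ⟨x, ⟨hxE, hxD⟩, hx⟩ := exists_pointCodim_le hadj
      refine hP x hx ζ η hζ hη ?_ ?_ (ih ζ hζ hζE)
      · rw [specializes_iff_mem_closure, hζE]; exact hxE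
      · rw [specializes_iff_mem_closure, hηD]; exact hxD
  exact key _ hrel ξ' hξ' rfl

end Components

/-! ### Depth at points with proper generizations -/

section Dimension

variable {X : Scheme.{u}} {F : X.Modules}

/-- The prime ideal of the local ring at `x` given by a generization of `x`. -/
def specPrime {ξ x : X} (h : ξ ⤳ x) : PrimeSpectrum (X.presheaf.stalk x) :=
  PrimeSpectrum.comap (X.presheaf.stalkSpecializes h).hom
    (IsLocalRing.closedPoint (X.presheaf.stalk ξ))

theorem germ_mem_specPrime_iff {ξ x : X} (h : ξ ⤳ x) {W : X.Opens} (hx : x ∈ W) (a : Γ(X, W)) :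
    X.presheaf.germ W x hx a ∈ (specPrime h).asIdeal ↔ ξ ∉ X.basicOpen a := by
  rw [← germ_mem_maximalIdeal_iff (h.mem_open W.2 hx)]
  change X.presheaf.stalkSpecializes h (X.presheaf.germ W x hx a) ∈
    IsLocalRing.maximalIdeal (X.presheaf.stalk ξ) ↔ _
  rw [TopCat.Presheaf.germ_stalkSpecializes_apply]

/-- A proper generization gives a strictly smaller prime. -/
theorem specPrime_lt {η ξ x : X} (h : ξ ⤳ x) (h' : η ⤳ ξ) (hne : ¬ ξ ⤳ η) :
    specPrime (h'.trans h) < specPrime h := by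
  refine lt_of_le_of_ne (fun r hr => ?_) fun heq => hne ?_
  · obtain ⟨W, hx, a, rfl⟩ := X.presheaf.exists_germ_eq r
    rw [germ_mem_specPrime_iff] at hr ⊢
    exact fun hξ => hr (h'.mem_open (X.basicOpen a).2 hξ)
  · obtain ⟨W, hW, hx, -⟩ := X.isBasis_affineOpens.exists_subset_of_mem_open
      (Set.mem_univ x) isOpen_univ
    obtain ⟨W, hW, rfl⟩ := hW
    refine specializes_of_forall_mem_basicOpen hW ((h'.trans h).mem_open W.2 hx) fun a ha => ?_
    by_contra hξ
    rw [← germ_mem_specPrime_iff h hx, ← heq, germ_mem_specPrime_iff] at hξ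
    exact hξ ha

theorem IsCoherent.specPrime_mem_support (hF : IsCoherent F) {ξ x : X} (h : ξ ⤳ x)
    (hξ : ξ ∈ Supp F) : specPrime h ∈ Module.support (X.presheaf.stalk x) (Stalk F x) := by
  rw [Module.mem_support_iff']
  have : Nontrivial (Stalk F ξ) := hξ
  obtain ⟨z, hz⟩ := exists_ne (0 : Stalk F ξ)
  obtain ⟨u, w, hu, huw⟩ := hF.exists_smul_eq_specMap h z
  refine ⟨w, fun r hr hrw => hz ?_⟩
  have hr' : IsUnit (X.presheaf.stalkSpecializes h r) := by
    by_contra hr'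
    exact hr hr'
  rw [← hu.smul_eq_zero, huw, ← hr'.smul_eq_zero, ← specMap_smul, hrw, map_zero]

/-- A point `x` of the support with a proper generization `η` in the support has `dim F_x ≥ 1`, and
so has depth at least one by `(S₂)`. -/
theorem SatisfiesS.one_le_depth (hS : SatisfiesS 2 F) (hF : IsCoherent F) {x η : X}
    (hx : x ∈ Supp F) (hη : η ∈ Supp F) (h : η ⤳ x) (hne : ¬ x ⤳ η) :
    1 ≤ depth (X.presheaf.stalk x) (Stalk F x) := by
  let a : Module.support (X.presheaf.stalk x) (Stalk F x) :=
    ⟨specPrime h, hF.specPrime_mem_support h hη⟩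
  let b : Module.support (X.presheaf.stalk x) (Stalk F x) :=
    ⟨specPrime (specializes_refl x), hF.specPrime_mem_support _ hx⟩
  have hab : a < b := specPrime_lt (specializes_refl x) h hne
  have h1 : (1 : ℕ∞) ≤ Order.height b :=
    le_trans (by simp) (Order.height_add_one_le hab)
  have hdim : ((1 : ℕ∞) : WithBot ℕ∞) ≤ Module.supportDim (X.presheaf.stalk x) (Stalk F x) :=
    le_trans (WithBot.coe_le_coe.mpr h1) (Order.height_le_krullDim b)
  exact WithBot.coe_le_coe.mp ((le_min (WithBot.coe_le_coe.mpr (by norm_num)) hdim).trans (hS x hx))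

/-- A chain of two proper generizations in the support gives `dim F_x ≥ 2`, and so depth at least
two by `(S₂)`. -/
theorem SatisfiesS.two_le_depth (hS : SatisfiesS 2 F) (hF : IsCoherent F) {x η₁ η₂ : X}
    (hx : x ∈ Supp F) (hη₁ : η₁ ∈ Supp F) (hη₂ : η₂ ∈ Supp F) (h₁ : η₁ ⤳ x) (h₂ : η₂ ⤳ η₁)
    (hne₁ : ¬ x ⤳ η₁) (hne₂ : ¬ η₁ ⤳ η₂) :
    2 ≤ depth (X.presheaf.stalk x) (Stalk F x) := by
  let a : Module.support (X.presheaf.stalk x) (Stalk F x) :=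
    ⟨specPrime (h₂.trans h₁), hF.specPrime_mem_support _ hη₂⟩
  let b : Module.support (X.presheaf.stalk x) (Stalk F x) :=
    ⟨specPrime h₁, hF.specPrime_mem_support _ hη₁⟩
  let c : Module.support (X.presheaf.stalk x) (Stalk F x) :=
    ⟨specPrime (specializes_refl x), hF.specPrime_mem_support _ hx⟩
  have hab : a < b := specPrime_lt h₁ h₂ hne₂
  have hbc : b < c := specPrime_lt (specializes_refl x) h₁ hne₁
  have h1 : (1 : ℕ∞) ≤ Order.height b :=
    le_trans (by simp) (Order.height_add_one_le hab)
  have h2 : (2 : ℕ∞) ≤ Order.height c := by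
    refine le_trans ?_ (Order.height_add_one_le hbc)
    rw [← one_add_one_eq_two]
    gcongr
  have hdim : ((2 : ℕ∞) : WithBot ℕ∞) ≤ Module.supportDim (X.presheaf.stalk x) (Stalk F x) :=
    le_trans (WithBot.coe_le_coe.mpr h2) (Order.height_le_krullDim c)
  exact WithBot.coe_le_coe.mp ((le_min le_rfl hdim).trans (hS x hx))

end Dimension

/-! ### Decompositions and idempotents -/

section Splittings

variable {C : Type*} [Category* C] [Preadditive C] [HasFiniteBiproducts C]

/-- The idempotent endomorphism given by a summand of a decomposition. -/
def summandProj {F : C} {r : ℕ} {G : Fin r → C} (e : F ≅ ⨁ G) (i : Fin r) : F ⟶ F :=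
  e.hom ≫ biproduct.π G i ≫ biproduct.ι G i ≫ e.inv

section

variable {F : C} {r : ℕ} {G : Fin r → C} (e : F ≅ ⨁ G)

theorem inclusion_comp_projection (i : Fin r) :
    (biproduct.ι G i ≫ e.inv) ≫ e.hom ≫ biproduct.π G i = 𝟙 (G i) := by simp

theorem projection_comp_inclusion (i : Fin r) :
    (e.hom ≫ biproduct.π G i) ≫ biproduct.ι G i ≫ e.inv = summandProj e i := by
  simp [summandProj]

theorem summandProj_comp_self (i : Fin r) :
    summandProj e i ≫ summandProj e i = summandProj e i := by
  simp [summandProj]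

theorem summandProj_comp_of_ne {i j : Fin r} (h : i ≠ j) :
    summandProj e i ≫ summandProj e j = 0 := by
  simp [summandProj, biproduct.ι_π_ne_assoc G h]

theorem sum_summandProj : ∑ i, summandProj e i = 𝟙 F := by
  have h : ∑ i, summandProj e i = e.hom ≫ (∑ i, biproduct.π G i ≫ biproduct.ι G i) ≫ e.inv := by
    rw [Preadditive.sum_comp, Preadditive.comp_sum]
    exact Finset.sum_congr rfl fun i _ => by simp [summandProj]
  have h1 : ∑ i, biproduct.π G i ≫ biproduct.ι G i = 𝟙 (⨁ G) := biproduct.total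
  rw [h, h1, Category.id_comp, e.hom_inv_id]

theorem isZero_of_summandProj_eq_zero {i : Fin r} (h : summandProj e i = 0) : IsZero (G i) := by
  rw [IsZero.iff_id_eq_zero, ← inclusion_comp_projection e i]
  calc _ = (biproduct.ι G i ≫ e.inv) ≫ summandProj e i ≫ e.hom ≫ biproduct.π G i := by
        simp [summandProj]
    _ = 0 := by rw [h]; simp

end

/-- A complete family of orthogonal idempotents comes from a decomposition. -/
theorem exists_iso_biproduct_of_idempotents [IsIdempotentComplete C] {F : C} {r : ℕ}
    (E : Fin r → (F ⟶ F)) (hidem : ∀ i, E i ≫ E i = E i) (horth : ∀ i j, i ≠ j → E i ≫ E j = 0)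
    (hsum : ∑ i, E i = 𝟙 F) :
    ∃ (G : Fin r → C) (e : F ≅ ⨁ G), ∀ i, summandProj e i = E i := by
  have h := fun i => IsIdempotentComplete.idempotents_split F (E i) (hidem i)
  choose G inc q hiq hqi using h
  have hne : ∀ i j, i ≠ j → inc i ≫ q j = 0 := fun i j hij => by
    calc inc i ≫ q j = (inc i ≫ q i) ≫ inc i ≫ q j ≫ inc j ≫ q j := by simp [hiq]
      _ = inc i ≫ (E i ≫ E j) ≫ q j := by rw [← hqi, ← hqi]; simp
      _ = 0 := by rw [horth i j hij]; simp
  let e : F ≅ ⨁ G :=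
    { hom := biproduct.lift q
      inv := biproduct.desc inc
      hom_inv_id := by rw [biproduct.lift_desc, ← hsum]; exact Finset.sum_congr rfl fun i _ => hqi i
      inv_hom_id := by
        refine biproduct.hom_ext _ _ fun j => biproduct.hom_ext' _ _ fun i => ?_
        rcases eq_or_ne i j with rfl | hij
        · simp [hiq]
        · rw [Category.assoc, biproduct.lift_π, biproduct.ι_desc_assoc, Category.id_comp,
            hne _ _ hij, biproduct.ι_π_ne G hij] }
  exact ⟨G, e, fun i => by simp [summandProj, e, hqi]⟩

/-- Two splittings of the same idempotent are isomorphic. -/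
theorem exists_iso_of_splittings {C : Type*} [Category* C] {F G H : C} {i : G ⟶ F}
    {q : F ⟶ G} {j : H ⟶ F} {t : F ⟶ H} (hiq : i ≫ q = 𝟙 G) (hjt : j ≫ t = 𝟙 H)
    (h : q ≫ i = t ≫ j) :
    ∃ φ : H ≅ G, j = φ.hom ≫ i :=
  ⟨{ hom := j ≫ q
     inv := i ≫ t
     hom_inv_id := by
      rw [Category.assoc, reassoc_of% h, hjt, Category.comp_id, hjt]
     inv_hom_id := by
      rw [Category.assoc, ← reassoc_of% h, hiq, Category.comp_id, hiq] }, by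
    rw [Category.assoc, h, reassoc_of% hjt]⟩

end Splittings

/-! ### Direct summands of coherent sheaves -/

section Retracts

variable {X : Scheme.{u}} {F G : X.Modules}

/-- Two decompositions with the same projections consist of the same subsheaves. -/
theorem sameDecomposition_of_summandProj_eq {r s : ℕ} {G : Fin r → X.Modules}
    {H : Fin s → X.Modules} (e : F ≅ ⨁ G) (e' : F ≅ ⨁ H) (τ : Fin s ≃ Fin r)
    (h : ∀ j, summandProj e' j = summandProj e (τ j)) : SameDecomposition e e' τ := fun j =>
  exists_iso_of_splittings (inclusion_comp_projection e (τ j))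
    (inclusion_comp_projection e' j) <| by
    rw [projection_comp_inclusion, projection_comp_inclusion, h]

theorem stalkHom_comp_stalkHom_eq_id {i : G ⟶ F} {q : F ⟶ G} (hiq : i ≫ q = 𝟙 G) (x : X) :
    stalkHom q x ∘ₗ stalkHom i x = LinearMap.id := by
  rw [← stalkHom_comp, hiq, stalkHom_id]

/-- A direct summand of a coherent sheaf is coherent: on an affine chart the idempotent of `M~`
comes from one of the module `M`, since `tilde` is fully faithful, and the summand is the
sheaf of its image. -/
theorem IsCoherent.of_retract (hF : IsCoherent F) {i : G ⟶ F} {q : F ⟶ G} (hiq : i ≫ q = 𝟙 G) :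
    IsCoherent G := by
  intro x
  obtain ⟨R, f, hf, M, hx, hM, ⟨a⟩⟩ := hF x
  let p : tilde M ⟶ tilde M := a.inv ≫ (restrictFunctor f).map (q ≫ i) ≫ a.hom
  have hp : p ≫ p = p := by
    have : (q ≫ i) ≫ q ≫ i = q ≫ i := by rw [Category.assoc, reassoc_of% hiq]
    simp only [p, Category.assoc, Iso.hom_inv_id_assoc]
    rw [← Functor.map_comp_assoc, this]
  obtain ⟨p', hp'⟩ : ∃ p' : M ⟶ M, tilde.map p' = p := (tilde.functor R).map_surjective p
  have hidem : p' ≫ p' = p' := (tilde.functor R).map_injective <| by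
    change tilde.map (p' ≫ p') = tilde.map p'
    rw [tilde.map_comp, hp', hp]
  obtain ⟨N, j, t, hjt, htj⟩ := IsIdempotentComplete.idempotents_split M p' hidem
  have hN : Module.Finite R N := Module.Finite.of_surjective t.hom <|
    Function.RightInverse.surjective (g := j.hom) fun n => congr($(hjt).hom n)
  obtain ⟨φ, -⟩ := exists_iso_of_splittings (i := tilde.map j)
    (q := tilde.map t) (j := (restrictFunctor f).map i ≫ a.hom)
    (t := a.inv ≫ (restrictFunctor f).map q)
    (by rw [← tilde.map_comp, hjt, tilde.map_id])
    (by rw [Category.assoc, Iso.hom_inv_id_assoc, ← Functor.map_comp, hiq,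
      CategoryTheory.Functor.map_id])
    (by rw [← tilde.map_comp, htj, hp']; simp [p])
  exact ⟨R, f, hf, N, hx, hN, ⟨φ⟩⟩

theorem SatisfiesS.of_retract {n : ℕ} (hF : IsCoherent F) (hS : SatisfiesS n F) {i : G ⟶ F}
    {q : F ⟶ G} (hiq : i ≫ q = 𝟙 G) : SatisfiesS n G := by
  intro x hx
  have hcomp := stalkHom_comp_stalkHom_eq_id hiq x
  have hinj : Function.Injective (stalkHom i x) :=
    Function.LeftInverse.injective (g := stalkHom q x) fun z => LinearMap.congr_fun hcomp z
  have : Nontrivial (Stalk G x) := hx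
  have := (hF.of_retract hiq).finite_stalk x
  have hxF : x ∈ Supp F := hinj.nontrivial
  refine (min_le_min_left _ (Module.supportDim_le_of_injective _ hinj)).trans ((hS x hxF).trans ?_)
  exact WithBot.coe_le_coe.mpr (depth_le_depth_of_retract _ _ hcomp)

/-- The support of a direct summand is where the stalks of its projection are nonzero. -/
theorem stalkHom_retract_eq_zero_iff {i : G ⟶ F} {q : F ⟶ G} (hiq : i ≫ q = 𝟙 G) (x : X) :
    stalkHom (q ≫ i) x = 0 ↔ x ∉ Supp G := by
  have hcomp := stalkHom_comp_stalkHom_eq_id hiq x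
  constructor
  · intro h hx
    have : Nontrivial (Stalk G x) := hx
    obtain ⟨z, hz⟩ := exists_ne (0 : Stalk G x)
    refine hz ?_
    have h1 : stalkHom q x (stalkHom (q ≫ i) x (stalkHom i x z)) = z := by
      rw [stalkHom_comp, LinearMap.comp_apply]
      have h2 := LinearMap.congr_fun hcomp
      simp only [LinearMap.comp_apply, LinearMap.id_apply] at h2
      rw [h2, h2]
    rw [← h1, h, LinearMap.zero_apply, map_zero]
  · intro hx
    have : Subsingleton (Stalk G x) := not_nontrivial_iff_subsingleton.mp hx
    ext z
    rw [stalkHom_comp, LinearMap.comp_apply, Subsingleton.elim (stalkHom q x z) 0, map_zero]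
    rfl

theorem stalkHom_eq_zero_or_eq_id {x : X} (hx : IndecomposableStalk F x) {p : F ⟶ F}
    (hp : p ≫ p = p) : stalkHom p x = 0 ∨ stalkHom p x = LinearMap.id := by
  have h : ModuleCat.ofHom (stalkHom p x) ≫ ModuleCat.ofHom (stalkHom p x) =
      ModuleCat.ofHom (stalkHom p x) := by
    rw [← ModuleCat.ofHom_comp, ← stalkHom_comp, hp]
  rcases Indecomposable.eq_zero_or_eq_id hx _ h with h | h
  · exact Or.inl (congrArg ModuleCat.Hom.hom h)
  · exact Or.inr (congrArg ModuleCat.Hom.hom h)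

theorem id_ne_zero_of_mem_supp {x : X} (hx : x ∈ Supp F) :
    (LinearMap.id : Stalk F x →ₗ[X.presheaf.stalk x] Stalk F x) ≠ 0 := by
  intro h
  have : Nontrivial (Stalk F x) := hx
  obtain ⟨z, hz⟩ := exists_ne (0 : Stalk F x)
  exact hz (LinearMap.congr_fun h z)

end Retracts

/-! ### Uniqueness of decompositions into indecomposables -/

section KrullSchmidt

variable {C : Type*} [Category* C] [Preadditive C] [HasFiniteBiproducts C]
  {F : C} {r : ℕ} {G : Fin r → C} {e : F ≅ ⨁ G}

theorem summandProj_ne_zero {i : Fin r} (h : ¬ IsZero (G i)) : summandProj e i ≠ 0 :=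
  fun h' => h (isZero_of_summandProj_eq_zero e h')

/-- A summand whose projection is, on either side, killed or fixed by every idempotent endomorphism
is indecomposable: an idempotent of the summand extends by zero to the whole object. -/
theorem indecomposable_summand [HasBinaryBiproducts C]
    (hp : ∀ p : F ⟶ F, p ≫ p = p → ∀ i,
      (summandProj e i ≫ p = 0 ∧ p ≫ summandProj e i = 0) ∨
      (summandProj e i ≫ p = summandProj e i ∧ p ≫ summandProj e i = summandProj e i))
    {i : Fin r} (hG : ¬ IsZero (G i)) : Indecomposable (G i) := by
  refine indecomposable_of_idempotents hG fun g hg => ?_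
  let p : F ⟶ F := (e.hom ≫ biproduct.π G i) ≫ g ≫ biproduct.ι G i ≫ e.inv
  have hgp : g = (biproduct.ι G i ≫ e.inv) ≫ (summandProj e i ≫ p) ≫ e.hom ≫ biproduct.π G i := by
    simp [p, summandProj]
  have hidem : p ≫ p = p := by
    simp [p, reassoc_of% hg]
  rcases hp p hidem i with h | h
  · left
    rw [hgp, h.1]
    simp
  · right
    rw [hgp, h.1]
    simp [summandProj]

/-- If each summand of a decomposition is, on either side, killed or fixed by every idempotent
endomorphism, then every decomposition into indecomposables has the same projections. -/
theorem exists_equiv_summandProj_eq [HasBinaryBiproducts C] [IsIdempotentComplete C]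
    (hG : ∀ i, ¬ IsZero (G i))
    (hp : ∀ p : F ⟶ F, p ≫ p = p → ∀ i,
      (summandProj e i ≫ p = 0 ∧ p ≫ summandProj e i = 0) ∨
      (summandProj e i ≫ p = summandProj e i ∧ p ≫ summandProj e i = summandProj e i))
    {s : ℕ} {H : Fin s → C} (e' : F ≅ ⨁ H) (hH : ∀ j, Indecomposable (H j)) :
    ∃ τ : Fin s ≃ Fin r, ∀ j, summandProj e' j = summandProj e (τ j) := by
  have hp' := fun j => hp (summandProj e' j) (summandProj_comp_self e' j)
  have hex : ∀ i, ∃ j, summandProj e' j ≫ summandProj e i = summandProj e i := by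
    intro i
    by_contra! hcon
    refine summandProj_ne_zero (e := e) (hG i) ?_
    rw [← Category.id_comp (summandProj e i), ← sum_summandProj e', Preadditive.sum_comp]
    exact Finset.sum_eq_zero fun j _ => ((hp' j i).resolve_right fun h => hcon j h.2).2
  -- `σ i` is the unique index `j` for which the `j`-th projection of `e'` fixes the summand `G i`
  choose σ hσ using hex
  have hcomm : ∀ i, summandProj e i ≫ summandProj e' (σ i) = summandProj e i := fun i =>
    ((hp' (σ i) i).resolve_left fun h =>
      summandProj_ne_zero (e := e) (hG i) ((hσ i).symm.trans h.2)).1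
  have hzero : ∀ i j, j ≠ σ i → summandProj e' j ≫ summandProj e i = 0 := by
    intro i j hj
    rw [← hσ i, ← Category.assoc, summandProj_comp_of_ne e' hj, zero_comp]
  have hsum : ∀ j, summandProj e' j = ∑ i, summandProj e' j ≫ summandProj e i := fun j => by
    rw [← Preadditive.comp_sum, sum_summandProj, Category.comp_id]
  have hsurj : Function.Surjective σ := by
    intro j
    by_contra! hcon
    refine summandProj_ne_zero (e := e') (hH j).1 ?_
    rw [hsum]
    exact Finset.sum_eq_zero fun i _ => hzero i j (hcon i).symm
  have hinj : Function.Injective σ := by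
    intro i i' hii
    by_contra hne
    -- the idempotent of `H (σ i)` induced by the `i`-th projection would be nontrivial
    let g : H (σ i) ⟶ H (σ i) := (biproduct.ι H (σ i) ≫ e'.inv) ≫ summandProj e i ≫
      e'.hom ≫ biproduct.π H (σ i)
    have hg : (e'.hom ≫ biproduct.π H (σ i)) ≫ g ≫ biproduct.ι H (σ i) ≫ e'.inv =
        summandProj e i := by
      calc _ = (summandProj e' (σ i) ≫ summandProj e i) ≫ summandProj e' (σ i) := by
            simp only [g, ← projection_comp_inclusion e', Category.assoc]
        _ = _ := by rw [hσ, hcomm]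
    have hgg : g ≫ g = g := by
      calc g ≫ g = (biproduct.ι H (σ i) ≫ e'.inv) ≫
            ((summandProj e i ≫ summandProj e' (σ i)) ≫ summandProj e i) ≫
              e'.hom ≫ biproduct.π H (σ i) := by
            simp only [g, ← projection_comp_inclusion e', Category.assoc]
        _ = g := by rw [hcomm, summandProj_comp_self]
    rcases Indecomposable.eq_zero_or_eq_id (hH (σ i)) g hgg with h | h
    · refine summandProj_ne_zero (e := e) (hG i) ?_
      rw [← hg, h]
      simp
    · rw [h, Category.id_comp, projection_comp_inclusion] at hg
      refine summandProj_ne_zero (e := e) (hG i') ?_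
      rw [← hσ i', ← hii, hg, summandProj_comp_of_ne e hne]
  let τ : Fin r ≃ Fin s := Equiv.ofBijective σ ⟨hinj, hsurj⟩
  refine ⟨τ.symm, fun j => ?_⟩
  have hj : σ (τ.symm j) = j := τ.apply_symm_apply j
  rw [hsum, Finset.sum_eq_single (τ.symm j) (fun i _ hi => hzero i j fun h => hi ?_) (by simp)]
  · calc _ = summandProj e' (σ (τ.symm j)) ≫ summandProj e (τ.symm j) := by rw [hj]
      _ = _ := hσ _
  · exact (τ.symm_apply_eq.mpr h).symm

end KrullSchmidt

/-! ### The decomposition along the components in codimension one -/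

section Decomposition

variable {X : Scheme.{u}} {F : X.Modules}

theorem IsCoherent.quasiSober_supp (hF : IsCoherent F) : QuasiSober (Supp F) :=
  hF.isClosed_supp.isClosedEmbedding_subtypeVal.quasiSober

theorem specializes_coe_iff {S : Set X} {x y : S} : (x : X) ⤳ (y : X) ↔ x ⤳ y :=
  Topology.IsInducing.subtypeVal.specializes_iff

/-- An endomorphism of a coherent sheaf satisfying `(S₂)` is determined by its stalks at the
generic points of the support, as these are the only points of the support of depth zero. -/
theorem SatisfiesS.end_ext [IsLocallyNoetherian X] (hS : SatisfiesS 2 F) (hF : IsCoherent F)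
    {φ ψ : F ⟶ F} (h : ∀ ξ : Supp F, IsGenericPt ξ → stalkHom φ ξ = stalkHom ψ ξ) : φ = ψ := by
  refine hF.hom_ext_of_depth fun ξ hξ => ?_
  by_cases hmem : ξ ∈ Supp F
  · refine h ⟨ξ, hmem⟩ fun η hη => ?_
    by_contra hne
    exact hξ (hS.one_le_depth hF hmem η.2 (specializes_coe_iff.mpr hη)
      fun h => hne (specializes_coe_iff.mp h))
  · have : Subsingleton (Stalk F ξ) := not_nontrivial_iff_subsingleton.mp hmem
    ext z
    exact Subsingleton.elim _ _

theorem stalkHom_summandProj_eq_zero {r : ℕ} {G : Fin r → X.Modules} (e : F ≅ ⨁ G) {i : Fin r}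
    {x : X} (h : x ∉ Supp (G i)) : stalkHom (summandProj e i) x = 0 := by
  rw [← projection_comp_inclusion]
  exact (stalkHom_retract_eq_zero_iff (inclusion_comp_projection e i) x).mpr h

theorem stalkHom_summandProj_eq_id {r : ℕ} {G : Fin r → X.Modules} (e : F ≅ ⨁ G) {i : Fin r}
    {x : X} (h : ∀ j, j ≠ i → x ∉ Supp (G j)) :
    stalkHom (summandProj e i) x = LinearMap.id := by
  rw [← stalkHom_id, ← sum_summandProj e, stalkHom_sum, Finset.sum_eq_single i]
  · exact fun j _ hj => stalkHom_summandProj_eq_zero e (h j hj)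
  · simp

variable {r : ℕ} {T : Fin r → Set X}

/-- A closed covering `T` of `Supp F` whose members meet only at points of depth at least two,
and such that each generic point of `Supp F` lies in only one member, while every point of `T i`
is a specialization of a generic point in `T i`. -/
structure IsGenericPartition (F : X.Modules) (T : Fin r → Set X) : Prop where
  isClosed i : IsClosed (T i)
  iUnion_eq : ⋃ i, T i = Supp F
  two_le_depth i j : i ≠ j → ∀ x ∈ T i ∩ T j, 2 ≤ depth (X.presheaf.stalk x) (Stalk F x)
  eq_of_mem {i j} (ξ : Supp F) : IsGenericPt ξ → (ξ : X) ∈ T i → (ξ : X) ∈ T j → i = j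
  exists_isGenericPt i : ∀ x ∈ T i, ∃ ξ : Supp F, IsGenericPt ξ ∧ (ξ : X) ∈ T i ∧ (ξ : X) ⤳ x

theorem IsGenericPartition.stalkHom_eq_id {G : Fin r → X.Modules} {e : F ≅ ⨁ G}
    (hT : IsGenericPartition F T) (hG : ∀ i, Supp (G i) = T i) {ξ : Supp F} (hξ : IsGenericPt ξ)
    {i : Fin r} (hi : (ξ : X) ∈ T i) : stalkHom (summandProj e i) ξ = LinearMap.id :=
  stalkHom_summandProj_eq_id e fun j hj hmem =>
    hj (hT.eq_of_mem ξ hξ (by rwa [hG] at hmem) hi)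

/-- The projections obtained from `exists_projection` by separating each `T i` from the others are a
complete family of orthogonal idempotents, as can be checked at the generic points. -/
theorem IsGenericPartition.exists_decomposition [IsLocallyNoetherian X]
    (hT : IsGenericPartition F T) (hF : IsCoherent F) (hS : SatisfiesS 2 F) :
    ∃ (G : Fin r → X.Modules) (_ : F ≅ ⨁ G),
      ∀ i, IsCoherent (G i) ∧ SatisfiesS 2 (G i) ∧ Supp (G i) = T i := by
  have hex : ∀ i, ∃ E : F ⟶ F, (∀ x ∉ ⋃ j ∈ {j | j ≠ i}, T j, stalkHom E x = LinearMap.id) ∧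
      ∀ x ∉ T i, stalkHom E x = 0 := by
    intro i
    refine exists_projection hF (hT.isClosed i)
      (Set.Finite.isClosed_biUnion (Set.toFinite _) fun j _ => hT.isClosed j) ?_ ?_
    · rw [← hT.iUnion_eq]
      refine Set.iUnion_subset fun j x hx => ?_
      rcases eq_or_ne j i with rfl | hj
      · exact Or.inl hx
      · exact Or.inr (Set.mem_biUnion hj hx)
    · rintro x ⟨hx, hx'⟩
      obtain ⟨j, hj, hxj⟩ := Set.mem_iUnion₂.mp hx'
      exact hT.two_le_depth i j (Ne.symm hj) x ⟨hx, hxj⟩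
  choose E hE_id hE_zero using hex
  have hid : ∀ i (ξ : Supp F), IsGenericPt ξ → (ξ : X) ∈ T i →
      stalkHom (E i) ξ = LinearMap.id := by
    intro i ξ hξ hi
    refine hE_id i _ fun hmem => ?_
    obtain ⟨j, hj, hξj⟩ := Set.mem_iUnion₂.mp hmem
    exact hj (hT.eq_of_mem ξ hξ hξj hi)
  have hmem : ∀ ξ : Supp F, ∃ i, (ξ : X) ∈ T i := fun ξ =>
    Set.mem_iUnion.mp (hT.iUnion_eq.ge ξ.2)
  obtain ⟨G, e, he⟩ := exists_iso_biproduct_of_idempotents E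
    (fun i => hS.end_ext hF fun ξ hξ => by
      rw [stalkHom_comp]
      by_cases hi : (ξ : X) ∈ T i
      · rw [hid i ξ hξ hi, LinearMap.id_comp]
      · rw [hE_zero i _ hi, LinearMap.comp_zero])
    (fun i j hij => hS.end_ext hF fun ξ hξ => by
      rw [stalkHom_comp, stalkHom_zero]
      by_cases hi : (ξ : X) ∈ T i
      · rw [hE_zero j _ fun hj => hij (hT.eq_of_mem ξ hξ hi hj), LinearMap.zero_comp]
      · rw [hE_zero i _ hi, LinearMap.comp_zero])
    (hS.end_ext hF fun ξ hξ => by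
      obtain ⟨i, hi⟩ := hmem ξ
      rw [stalkHom_sum, stalkHom_id, Finset.sum_eq_single i _ (by simp), hid i ξ hξ hi]
      exact fun j _ hj => hE_zero j _ fun h => hj (hT.eq_of_mem ξ hξ h hi))
  refine ⟨G, e, fun i => ?_⟩
  have hiq := inclusion_comp_projection e i
  refine ⟨hF.of_retract hiq, hS.of_retract hF hiq, Set.ext fun x => ?_⟩
  rw [← not_iff_not, ← stalkHom_retract_eq_zero_iff hiq, projection_comp_inclusion, he]
  refine ⟨fun h hx => ?_, hE_zero i x⟩
  obtain ⟨ξ, hξ, hξi, hspec⟩ := hT.exists_isGenericPt i x hx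
  refine id_ne_zero_of_mem_supp ξ.2 ?_
  rw [← hid i ξ hξ hξi, ← stalkHom_zero (F := F)]
  exact hF.stalkHom_eq_of_specializes hspec (h.trans (stalkHom_zero x).symm)

/-- The projections of a decomposition with supports `T i` are determined at the generic points,
where they are zero or the identity. -/
theorem IsGenericPartition.summandProj_eq [IsLocallyNoetherian X] (hT : IsGenericPartition F T)
    (hF : IsCoherent F) (hS : SatisfiesS 2 F) {G : Fin r → X.Modules} (e : F ≅ ⨁ G)
    (hG : ∀ i, Supp (G i) = T i) {s : ℕ} {H : Fin s → X.Modules} (e' : F ≅ ⨁ H)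
    (τ : Fin s ≃ Fin r) (hH : ∀ j, Supp (H j) = T (τ j)) (j : Fin s) :
    summandProj e' j = summandProj e (τ j) := by
  refine hS.end_ext hF fun ξ hξ => ?_
  by_cases hj : (ξ : X) ∈ T (τ j)
  · rw [hT.stalkHom_eq_id hG hξ hj, stalkHom_summandProj_eq_id]
    intro k hk hmem
    rw [hH] at hmem
    exact hk (τ.injective (hT.eq_of_mem ξ hξ hmem hj))
  · rw [stalkHom_summandProj_eq_zero e (by rwa [hG]), stalkHom_summandProj_eq_zero]
    rwa [hH]

/-- An endomorphism which is zero, or the identity, at the generic points of `T i` kills, or fixes,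
the summand supported in `T i`. -/
theorem SatisfiesS.comp_eq_zero_or_eq_self [IsLocallyNoetherian X]
    (hS : SatisfiesS 2 F) (hF : IsCoherent F)
    {G : Fin r → X.Modules} (e : F ≅ ⨁ G) (hG : ∀ i, Supp (G i) = T i) (p : F ⟶ F) (i : Fin r)
    (hp : (∀ ξ : Supp F, IsGenericPt ξ → (ξ : X) ∈ T i → stalkHom p ξ = 0) ∨
      ∀ ξ : Supp F, IsGenericPt ξ → (ξ : X) ∈ T i → stalkHom p ξ = LinearMap.id) :
    (summandProj e i ≫ p = 0 ∧ p ≫ summandProj e i = 0) ∨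
      (summandProj e i ≫ p = summandProj e i ∧ p ≫ summandProj e i = summandProj e i) := by
  refine hp.imp (fun hp => ⟨?_, ?_⟩) (fun hp => ⟨?_, ?_⟩) <;>
  · refine hS.end_ext hF fun ξ hξ => ?_
    by_cases hi : (ξ : X) ∈ T i
    · simp [stalkHom_comp, stalkHom_zero, hp ξ hξ hi]
    · simp [stalkHom_comp, stalkHom_zero, stalkHom_summandProj_eq_zero e (x := ξ) (by rwa [hG])]

/-- If the stalks at points of codimension at most one are indecomposable, an idempotent is zero at
all generic points of a connected component in codimension one, or the identity at all of them:
its value at a point of codimension at most one determines it at the generizations. -/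
theorem stalkHom_eq_zero_or_eq_id_of_mem_codimComponent [QuasiSober (Supp F)] (hF : IsCoherent F)
    (hind : ∀ x : Supp F, pointCodim x ≤ 1 → IndecomposableStalk F x) {p : F ⟶ F}
    (hp : p ≫ p = p) (C : irreducibleComponents (Supp F)) :
    (∀ ξ : Supp F, IsGenericPt ξ → ξ ∈ codimComponent 1 C → stalkHom p ξ = 0) ∨
      ∀ ξ : Supp F, IsGenericPt ξ → ξ ∈ codimComponent 1 C → stalkHom p ξ = LinearMap.id := by
  have hzero : ∀ {ξ x : Supp F}, ξ ⤳ x → stalkHom p (x : X) = 0 → stalkHom p (ξ : X) = 0 :=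
    fun h h' => (hF.stalkHom_eq_of_specializes (ψ := 0) (specializes_coe_iff.mpr h)
      (h'.trans (stalkHom_zero _).symm)).trans (stalkHom_zero _)
  have hid : ∀ {ξ x : Supp F}, ξ ⤳ x → stalkHom p (x : X) = LinearMap.id →
      stalkHom p (ξ : X) = LinearMap.id :=
    fun h h' => (hF.stalkHom_eq_of_specializes (ψ := 𝟙 F) (specializes_coe_iff.mpr h)
      (h'.trans (stalkHom_id _).symm)).trans (stalkHom_id _)
  obtain ⟨ξ₀, hξ₀, hC⟩ := exists_isGenericPt_closure_eq C
  have hmem : ξ₀ ∈ codimComponent 1 C := subset_codimComponent 1 C (hC ▸ subset_closure rfl)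
  rcases stalkHom_eq_zero_or_eq_id (hind ξ₀ (hξ₀.pointCodim_le 1)) hp with h | h
  · refine Or.inl fun ξ hξ hξC => IsGenericPt.induction_codimComponent
      (P := fun ξ : Supp F => stalkHom p (ξ : X) = 0) ?_ hξ₀ hξ hmem hξC h
    intro x hx η η' _ _ hη hη' hpη
    refine hzero hη' ((stalkHom_eq_zero_or_eq_id (hind x hx) hp).resolve_right fun h => ?_)
    exact id_ne_zero_of_mem_supp η.2 ((hid hη h).symm.trans hpη)
  · refine Or.inr fun ξ hξ hξC => IsGenericPt.induction_codimComponent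
      (P := fun ξ : Supp F => stalkHom p (ξ : X) = LinearMap.id) ?_ hξ₀ hξ hmem hξC h
    intro x hx η η' _ _ hη hη' hpη
    refine hid hη' ((stalkHom_eq_zero_or_eq_id (hind x hx) hp).resolve_left fun h => ?_)
    exact id_ne_zero_of_mem_supp η.2 (hpη.symm.trans (hzero hη h))

/-- The connected components in codimension one of the support, enumerated without repetition, form
a generic partition; where two of them meet, the support has a chain of two proper generizations,
so the depth is at least two by `(S₂)`. -/
theorem isGenericPartition_codimComponent [QuasiSober (Supp F)] [NoetherianSpace (Supp F)]
    (hF : IsCoherent F) (hS : SatisfiesS 2 F) {C : Fin r → irreducibleComponents (Supp F)}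
    (hinj : Function.Injective fun i => codimComponent 1 (C i))
    (hsurj : ∀ D, ∃ i, codimComponent 1 (C i) = codimComponent 1 D) :
    IsGenericPartition F fun i => Subtype.val '' codimComponent 1 (C i) where
  isClosed i := hF.isClosed_supp.isClosedEmbedding_subtypeVal.isClosedMap _
    (isClosed_codimComponent 1 (C i))
  iUnion_eq := by
    refine subset_antisymm (Set.iUnion_subset fun i => Subtype.coe_image_subset _ _) fun x hx => ?_
    let D : irreducibleComponents (Supp F) :=
      ⟨_, irreducibleComponent_mem_irreducibleComponents (⟨x, hx⟩ : Supp F)⟩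
    obtain ⟨i, hi⟩ := hsurj D
    refine Set.mem_iUnion.mpr ⟨i, ⟨x, hx⟩, ?_, rfl⟩
    rw [hi]
    exact subset_codimComponent 1 D mem_irreducibleComponent
  two_le_depth := by
    rintro i j hij _ ⟨⟨x, hi, rfl⟩, hj⟩
    rw [Subtype.val_injective.mem_set_image] at hj
    obtain ⟨η₁, η₂, h₁, h₂, hne₁, hne₂⟩ := exists_chain_of_codimComponent_ne (hinj.ne hij) hi hj
    rw [← specializes_coe_iff] at h₁ h₂ hne₁ hne₂
    exact hS.two_le_depth hF x.2 η₁.2 η₂.2 h₁ h₂ hne₁ hne₂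
  eq_of_mem ξ hξ hi hj := by
    rw [Subtype.val_injective.mem_set_image] at hi hj
    exact hinj (hξ.codimComponent_eq hi hj)
  exists_isGenericPt := by
    rintro i _ ⟨x, hx, rfl⟩
    obtain ⟨ξ, hξi, hξ, h⟩ := exists_isGenericPt_mem_codimComponent hx
    exact ⟨ξ, hξ, ⟨ξ, hξi, rfl⟩, specializes_coe_iff.mpr h⟩

theorem finite_codimComponents {Y : Type u} [TopologicalSpace Y] (k : ℕ∞) (S : Set Y)
    [NoetherianSpace S] : (codimComponents k S).Finite :=
  have : Finite (irreducibleComponents S) := NoetherianSpace.finite_irreducibleComponents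
  Set.finite_range _

theorem sUnion_codimComponents {Y : Type u} [TopologicalSpace Y] (k : ℕ∞) (S : Set Y) :
    ⋃₀ codimComponents k S = S := by
  refine subset_antisymm (Set.sUnion_subset ?_) fun x hx => ?_
  · rintro _ ⟨C, rfl⟩
    exact Subtype.coe_image_subset _ _
  · exact ⟨_, ⟨⟨_, irreducibleComponent_mem_irreducibleComponents (⟨x, hx⟩ : S)⟩, rfl⟩,
      ⟨x, hx⟩, subset_codimComponent k _ mem_irreducibleComponent, rfl⟩

end Decomposition

end S2Structure

end

theorem theorem3p4 (X : Scheme.{u}) [IsNoetherian X] (F : X.Modules)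
    (hF : S2Structure.IsCoherent F) (hS2 : S2Structure.SatisfiesS 2 F) (hne : ¬ IsZero F) :
    (S2Structure.codimComponents 1 (S2Structure.Supp F)).Finite ∧
    ⋃₀ S2Structure.codimComponents 1 (S2Structure.Supp F) = S2Structure.Supp F ∧
    ∀ (r : ℕ) (S : Fin r ≃ S2Structure.codimComponents 1 (S2Structure.Supp F)),
      ∃ (G : Fin r → X.Modules) (e : F ≅ ⨁ G),
        (∀ i, S2Structure.IsCoherent (G i) ∧ S2Structure.SatisfiesS 2 (G i) ∧
          S2Structure.Supp (G i) = (S i : Set X)) ∧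
        (∀ (s : ℕ) (H : Fin s → X.Modules) (e' : F ≅ ⨁ H) (τ : Fin s ≃ Fin r),
          (∀ j, S2Structure.IsCoherent (H j) ∧ S2Structure.Supp (H j) = (S (τ j) : Set X)) →
            S2Structure.SameDecomposition e e' τ) ∧
        (S2Structure.Equidimensional (S2Structure.Supp F) →
          (∀ x : S2Structure.Supp F, S2Structure.pointCodim x ≤ 1 →
            S2Structure.IndecomposableStalk F x) →
          (∀ i, Indecomposable (G i)) ∧
          ∀ (s : ℕ) (H : Fin s → X.Modules) (e' : F ≅ ⨁ H),
            (∀ j, S2Structure.IsCoherent (H j) ∧ Indecomposable (H j)) →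
              ∃ τ : Fin s ≃ Fin r, S2Structure.SameDecomposition e e' τ) := by
  have := hF.quasiSober_supp
  have : NoetherianSpace (S2Structure.Supp F) :=
    Topology.IsInducing.subtypeVal.noetherianSpace
  refine ⟨S2Structure.finite_codimComponents _ _, S2Structure.sUnion_codimComponents _ _,
    fun r S => ?_⟩
  choose C hC using fun i => (S i).2
  obtain ⟨T, hTS⟩ : ∃ T : Fin r → Set X, T = fun i => (S i : Set X) := ⟨_, rfl⟩
  have hTC : T = fun i => Subtype.val '' S2Structure.codimComponent 1 (C i) := by
    rw [hTS]; exact funext fun i => (hC i).symm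
  have hT : S2Structure.IsGenericPartition F T := by
    rw [hTC]
    refine S2Structure.isGenericPartition_codimComponent hF hS2 (fun i j hij => ?_) fun D => ?_
    · refine S.injective (Subtype.ext ?_)
      rw [← hC i, ← hC j]
      exact congrArg _ hij
    · obtain ⟨i, hi⟩ := S.surjective ⟨_, D, rfl⟩
      exact ⟨i, Subtype.val_injective.image_injective ((hC i).trans congr(($hi).val))⟩
  obtain ⟨G, e, hG⟩ := hT.exists_decomposition hF hS2
  have hsupp : ∀ i, S2Structure.Supp (G i) = T i := fun i => (hG i).2.2
  refine ⟨G, e, by simpa only [hTS] using hG, fun s H e' τ hH => ?_, fun _ hind => ?_⟩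
  · exact S2Structure.sameDecomposition_of_summandProj_eq e e' τ
      (hT.summandProj_eq hF hS2 e hsupp e' τ fun j => by rw [(hH j).2, hTS])
  have hG0 : ∀ i, ¬ IsZero (G i) := by
    intro i hzero
    obtain ⟨ξ, -, hi⟩ := S2Structure.exists_isGenericPt_closure_eq (C i)
    have hmem : (ξ : X) ∈ S2Structure.Supp (G i) := by
      rw [hsupp, hTC]
      exact ⟨ξ, S2Structure.subset_codimComponent 1 _ (hi ▸ subset_closure rfl), rfl⟩
    refine S2Structure.id_ne_zero_of_mem_supp hmem ?_
    rw [← S2Structure.stalkHom_id, hzero.eq_of_src (𝟙 _) 0, S2Structure.stalkHom_zero]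
  -- every idempotent is zero or the identity on each summand
  have hp : ∀ p : F ⟶ F, p ≫ p = p → ∀ i,
      (S2Structure.summandProj e i ≫ p = 0 ∧ p ≫ S2Structure.summandProj e i = 0) ∨
      (S2Structure.summandProj e i ≫ p = S2Structure.summandProj e i ∧
        p ≫ S2Structure.summandProj e i = S2Structure.summandProj e i) := by
    intro p hp i
    refine hS2.comp_eq_zero_or_eq_self hF e hsupp p i ?_
    simp only [hTC, Subtype.val_injective.mem_set_image]
    exact S2Structure.stalkHom_eq_zero_or_eq_id_of_mem_codimComponent hF hind hp (C i)
  refine ⟨fun i => S2Structure.indecomposable_summand hp (hG0 i), fun s H e' hH => ?_⟩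
  obtain ⟨τ, hτ⟩ := S2Structure.exists_equiv_summandProj_eq hG0 hp e' fun j => (hH j).2
  exact ⟨τ, S2Structure.sameDecomposition_of_summandProj_eq e e' τ hτ⟩
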